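/- Let $\mathcal Q$ be a finite set. For $k,l\in\mathcal Q$ let $f_k$ and $\lambda_{kl}$ be real polynomials with $f_k(0)=0$ and $\lambda_{kl}(x)\ge 0$ for $x>0$, and let $\gamma_{kl}\in\mathbb R$. Consider the stochastic hybrid system $(Q_t,X_t)$ on $\mathcal Q\times(0,\infty)$ in which, while $Q_t=k$, the continuous state follows $\dot x=f_k(x)$ (with flow $\varphi_k^s$), a jump from $k$ to $l$ ($l=k$ allowed) occurs at rate $\lambda_{kl}(X_t)$, and at such a jump $x$ is replaced by $\gamma_{kl}x$. Precisely: let $(Q_0,X_0)$ be a random initial state with $X_0>0$, independent of a family $S_n^{(l)}$ ($n\ge1$, $l\in\mathcal Q$) of i.i.d. exponential variables of parameter $1$, and put $T_0=0$. Given $(T_n,Q_{T_n},X_{T_n})=(T_n,k,x)$, let $T_{n+1}^{(l)}$ be the first time with $\int_0^{T_{n+1}^{(l)}-T_n}\lambda_{kl}(\varphi_k^s(x))\,ds=S_{n+1}^{(l)}$ (and $\infty$ if there is none), and let $T_{n+1}=\min_l T_{n+1}^{(l)}$. Then $Q_t=k$ and $X_t=\varphi_k^{t-T_n}(x)$ for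 $T_n\le t<T_{n+1}$; and if $T_{n+1}<\infty$, then $Q_{T_{n+1}}$ is the minimizing index $l$ and $X_{T_{n+1}}=\gamma_{kl}\,\varphi_k^{T_{n+1}-T_n}(x)$. One sets $X_t=\infty$ once the process has blown up, that is, once the jump times have accumulated or the solution of the differential equation has escaped to infinity. Let $\deg F=\max_k\deg f_k$ and $\deg\Lambda=\max_{k,l}\deg\lambda_{kl}$ (the zero polynomial being given degree $0$), and let $\beta_{kl}$ be the coefficient of $x^{\deg\Lambda}$ in $\lambda_{kl}$. Assume that $\deg F\le\deg\Lambda$ and that $\sum_{l}\beta_{kl}>0$ for every $k$. **Corollary.** If $0<\gamma_{kl}<1$ for all $k,l\in\mathcal Q$, then $X_t$ is a (possibly infinite) random variable for every $t\ge0$, and for every $m\in\mathbb N$ with $\mathbb E[X_0^m]<\infty$, $$\sup_{t\ge0}\mathbb E[X_t^m]<\infty .$$ -/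

import Mathlib

open MeasureTheory ProbabilityTheory Polynomial Set
open scoped ENNReal NNReal

namespace HybridSystem

noncomputable section

/-- `u` solves `u' = v(u)`, `u(0) = x` on `[0, s]` and stays in the phase space `(0, ∞)`. -/
def IsSolution (v : ℝ → ℝ) (x s : ℝ) (u : ℝ → ℝ) : Prop :=
  u 0 = x ∧ ∀ r ∈ Icc 0 s, 0 < u r ∧ HasDerivWithinAt u (v (u r)) (Icc 0 s) r

/-- The orbit of `x` under `v` exists on the whole of `[0, s]` (no blow-up up to time `s`). -/
def Survives (v : ℝ → ℝ) (x s : ℝ) : Prop :=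
  0 ≤ s ∧ ∃ u, IsSolution v x s u

open Classical in
/-- The flow map `φ^s(x)` of `v` on `(0, ∞)`; it is only used at times up to which the orbit
survives (the value is `0` otherwise). -/
def flow (v : ℝ → ℝ) (x s : ℝ) : ℝ :=
  if h : ∃ u, IsSolution v x s u then h.choose s else 0

/-- A stochastic hybrid system with discrete states `Q`, all continuous state spaces equal to
`(0, ∞)`, and deterministic (ODE) continuous dynamics.
`rate q l x` is the rate `λ_l(q, x)` of jumping to `l` from `(q, x)`, and `reset q l x` is the
continuous state `ψ_l(q, x)` right after such a jump. -/
structure SHS (Q : Type*) where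
  f : Q → ℝ → ℝ
  rate : Q → Q → ℝ → ℝ
  reset : Q → Q → ℝ → ℝ
  f_smooth : ∀ q, ContDiffOn ℝ 1 (f q) (Ioi 0)
  rate_continuous : ∀ q l, ContinuousOn (rate q l) (Ioi 0)
  rate_nonneg : ∀ q l x, 0 < x → 0 ≤ rate q l x
  reset_pos : ∀ q l x, 0 < x → 0 < reset q l x

/-- The system with polynomial vector fields `F q`, polynomial rates `Λ q l` and linear resets
`x ↦ γ q l * x`. -/
def SHS.ofPolynomials {Q : Type*} (F : Q → ℝ[X]) (Λ : Q → Q → ℝ[X]) (γ : Q → Q → ℝ)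
    (hΛ : ∀ k l x, 0 < x → 0 ≤ (Λ k l).eval x) (hγ : ∀ k l, 0 < γ k l) : SHS Q where
  f q x := (F q).eval x
  rate q l x := (Λ q l).eval x
  reset q l x := γ q l * x
  f_smooth q := by
    simpa [Polynomial.aeval_def] using ((F q).contDiff_aeval (𝕜 := ℝ) 1).contDiffOn
  rate_continuous q l := (Λ q l).continuous.continuousOn
  rate_nonneg := hΛ
  reset_pos q l _ hx := mul_pos (hγ q l) hx

section Construction

variable {Q : Type*}

/-- The waiting time `T^{(l)}` after which the transition to `l` would fire, when the system
enters `(q, x)` and the exponential clock of `l` has value `s`: the first `r` with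
`∫_0^r λ_l(q, φ^u(q, x)) du = s` (infinite if there is none). -/
def clock (H : SHS Q) (q : Q) (x : ℝ) (l : Q) (s : ℝ) : ℝ≥0∞ :=
  sInf (ENNReal.ofReal '' {r : ℝ | Survives (H.f q) x r ∧
    s ≤ ∫ u in (0 : ℝ)..r, H.rate q l (flow (H.f q) x u)})

/-- The waiting time until the next jump: the first of the clocks to ring. -/
def holdingTime (H : SHS Q) (q : Q) (x : ℝ) (s : Q → ℝ) : ℝ≥0∞ :=
  ⨅ l, clock H q x l (s l)

open Classical in
/-- The discrete state after the next jump: the index of the first clock to ring.  Ties, an event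
of probability zero, are broken by a fixed choice function on the set of minimizers. -/
def nextDiscrete [Fintype Q] (H : SHS Q) (q : Q) (x : ℝ) (s : Q → ℝ) : Q :=
  if h : (Finset.univ.filter fun l => clock H q x l (s l) = holdingTime H q x s).Nonempty
  then h.choose else q

/-- `jumpChain H q₀ x₀ s n = (T_n, Q_{T_n}, X_{T_n})`, where `s n` are the values of the
exponential clocks used for the `(n+1)`-st jump.  If the `n`-th jump never happens, then
`T_n = ∞` and the other two components are meaningless and are not used. -/
def jumpChain [Fintype Q] (H : SHS Q) (q₀ : Q) (x₀ : ℝ) (s : ℕ → Q → ℝ) :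
    ℕ → ℝ≥0∞ × Q × ℝ
  | 0 => (0, q₀, x₀)
  | n + 1 =>
    let p := jumpChain H q₀ x₀ s n
    let τ := holdingTime H p.2.1 p.2.2 (s n)
    let l := nextDiscrete H p.2.1 p.2.2 (s n)
    (p.1 + τ, l, H.reset p.2.1 l (flow (H.f p.2.1) p.2.2 τ.toReal))

open Classical in
/-- The combined state `(Q_t, X_t)`, or `none` if the process has blown up by time `t`, either
because the jump times accumulate or because the orbit of the ODE has escaped to infinity. -/
def state [Fintype Q] (H : SHS Q) (q₀ : Q) (x₀ : ℝ) (s : ℕ → Q → ℝ) (t : ℝ≥0) :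
    Option (Q × ℝ) :=
  if h : ∃ n, (jumpChain H q₀ x₀ s n).1 ≤ t ∧ (t : ℝ≥0∞) < (jumpChain H q₀ x₀ s (n + 1)).1 then
    let p := jumpChain H q₀ x₀ s (Nat.find h)
    let r := ((t : ℝ≥0∞) - p.1).toReal
    if Survives (H.f p.2.1) p.2.2 r then some (p.2.1, flow (H.f p.2.1) p.2.2 r) else none
  else none

/-- The continuous state `X_t`, with `X_t = ∞` after a blow-up. -/
def X [Fintype Q] (H : SHS Q) (q₀ : Q) (x₀ : ℝ) (s : ℕ → Q → ℝ) (t : ℝ≥0) : ℝ≥0∞ :=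
  (state H q₀ x₀ s t).elim ⊤ fun p => ENNReal.ofReal p.2

/-- The randomness of the construction: independent exponential variables `S n l` of parameter
`1`, independent of the initial state `(Q₀, X₀)`. -/
structure IsDriving [MeasurableSpace Q] {Ω : Type*} [MeasurableSpace Ω]
    (P : Measure Ω) (Q₀ : Ω → Q) (X₀ : Ω → ℝ) (S : ℕ → Q → Ω → ℝ) : Prop where
  measurable_Q₀ : Measurable Q₀
  measurable_X₀ : Measurable X₀
  measurable_S : ∀ n l, Measurable (S n l)
  law_S : ∀ n l, P.map (S n l) = expMeasure 1
  iIndep_S : iIndepFun (fun (i : ℕ × Q) => S i.1 i.2) P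
  indep_init : IndepFun (fun ω => (Q₀ ω, X₀ ω)) (fun ω (i : ℕ × Q) => S i.1 i.2 ω) P

end Construction

section Degree

variable {Q : Type*} [Fintype Q]

/-- `deg F`, the largest degree of the vector fields. -/
def degF (F : Q → ℝ[X]) : ℕ := Finset.univ.sup fun q => (F q).natDegree

/-- `deg Λ`, the largest degree of the rate functions. -/
def degRate (Λ : Q → Q → ℝ[X]) : ℕ :=
  Finset.univ.sup fun k => Finset.univ.sup fun l => (Λ k l).natDegree

/-- `β_{kl}`, the coefficient of degree `deg Λ` of the rate `λ_{kl}`. -/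
def topCoeff (Λ : Q → Q → ℝ[X]) (k l : Q) : ℝ := (Λ k l).coeff (degRate Λ)

end Degree

end

end HybridSystem

/-! Every jump multiplies the state by at most `g = max γ < 1`. For `m ≥ 1` the jumps therefore
contribute at most `-(1 - g ^ m) Λ_k(y) y ^ m` to the generator applied to `y ^ m`, where `Λ_k` is
the total rate. This has degree `deg Λ + m` and a negative leading coefficient, while the transport
term `m y ^ (m - 1) f_k(y)` has strictly lower degree because `deg F ≤ deg Λ`. `exists_drift`
extracts constants `c > 0` and `K ≥ 0` from this comparison, and even leaves a surplus `-Λ_k(y)`.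

The drift makes `W(s, y) = e^{-cs} y ^ m + (1 - e^{-cs}) K` a supersolution of the backward
equation, `s` being the time left until the horizon `t`. Since `W(0, y) = y ^ m` and `W(s, y) ≤ y ^
m + K`, it is a moment bound uniform in time. No generator or martingale theory is used, only one
jump at a time: `first_jump_le` shows that `W` at the start dominates the expected `y ^ m` at the
horizon if no jump occurs before it, plus the expected `W` after the first jump otherwise. The
surplus in the drift also pays a reward `ρ = e^{-ct}` for each jump up to the horizon.

Since the clocks of a jump are independent of the past, these estimates telescope along the jump
chain (`IsDriving.lintegral_X_pow_le`). The rewards give `ρ ∑ P(T_n ≤ t) < ∞`, so almost surely the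
jump times do not accumulate before `t`; the remaining terms add up to the moment of `X_t`.

Blow-up of the differential equation is excluded by `exists_mul_field_le_rate`: the field is
dominated by the total rate, so an orbit escapes only by accumulating infinite hazard, and a jump
comes first almost surely. Measurability is obtained by writing `p(x) = x q(x)`, passing to `z = log
x` and truncating, so that a flow with finite lifetime is exhausted by globally defined continuous
flows. -/

namespace HybridSystem

/-! ### Global flows of bounded Lipschitz fields. -/

section LipschitzFlow

lemma hasDerivWithinAt_Ici_of_Icc {u : ℝ → ℝ} {u' a b r : ℝ}
    (h : HasDerivWithinAt u u' (Icc a b) r) (hr : r ∈ Ico a b) :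
    HasDerivWithinAt u u' (Ici r) r := by
  refine h.mono_of_mem_nhdsWithin ?_
  exact Filter.mem_of_superset (Icc_mem_nhdsGE hr.2) (Icc_subset_Icc_left hr.1)

/-- A bounded Lipschitz vector field has a flow on `[0, T]`, jointly continuous in the initial
value and the time. -/
theorem exists_continuous_flow {h : ℝ → ℝ} {K L : ℝ≥0} (hK : LipschitzWith K h)
    (hL : ∀ z, ‖h z‖ ≤ L) {T : ℝ} (hT : 0 ≤ T) :
    ∃ Z : ℝ → ℝ → ℝ, Continuous (Function.uncurry Z) ∧ ∀ z, Z z 0 = z ∧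
      ∀ r ∈ Icc 0 T, HasDerivWithinAt (Z z) (h (Z z r)) (Icc 0 T) r := by
  have ex : ∀ z : ℝ, ∃ α : ℝ → ℝ, α 0 = z ∧
      ∀ r ∈ Icc 0 T, HasDerivWithinAt α (h (α r)) (Icc 0 T) r := by
    intro z
    -- The field is bounded by `L`, so an orbit moves by at most `L * T`; a ball of that radius
    -- gives existence on all of `[0, T]` at once.
    have hPL : IsPicardLindelof (fun _ => h) (⟨0, le_refl 0, hT⟩ : Icc (0 : ℝ) T) z
        (L * Real.toNNReal T) 0 L K := by
      refine IsPicardLindelof.of_time_independent (fun x _ => hL x) hK.lipschitzOnWith ?_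
      simp [hT]
    exact hPL.exists_eq_forall_mem_Icc_hasDerivWithinAt₀
  choose α hα0 hα using ex
  have hcont : ∀ z, ContinuousOn (α z) (Icc 0 T) := fun z r hr =>
    (hα z r hr).continuousWithinAt
  -- Clamping the time to `[0, T]` makes the flow defined and continuous on the whole plane: it is
  -- continuous in `z` by Grönwall and `L`-Lipschitz in time uniformly in `z`, which gives joint
  -- continuity.
  have hclamp : ∀ r : ℝ, max 0 (min r T) ∈ Icc 0 T := fun r =>
    ⟨le_max_left _ _, max_le hT (min_le_right _ _)⟩
  have hid : ∀ r ∈ Icc 0 T, max 0 (min r T) = r := fun r hr => by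
    rw [min_eq_left hr.2, max_eq_right hr.1]
  refine ⟨fun z r => α z (max 0 (min r T)), ?_, fun z => ⟨?_, fun r hr => ?_⟩⟩
  · have hz : ∀ r, Continuous fun z => α z (max 0 (min r T)) := by
      intro r
      have hlip : LipschitzWith (Real.toNNReal (Real.exp (K * T)))
          fun z => α z (max 0 (min r T)) := by
        refine LipschitzWith.of_dist_le_mul fun z z' => ?_
        have := dist_le_of_trajectories_ODE (v := fun _ => h) (K := K) (a := 0) (b := T)
          (fun _ => hK) (hcont z)
          (fun t ht => hasDerivWithinAt_Ici_of_Icc (hα z t (Ico_subset_Icc_self ht)) ht)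
          (hcont z')
          (fun t ht => hasDerivWithinAt_Ici_of_Icc (hα z' t (Ico_subset_Icc_self ht)) ht)
          (le_refl _) _ (hclamp r)
        rw [hα0, hα0] at this
        rw [Real.coe_toNNReal _ (Real.exp_pos _).le, mul_comm]
        refine this.trans (mul_le_mul_of_nonneg_left (Real.exp_le_exp.2 ?_) dist_nonneg)
        exact mul_le_mul_of_nonneg_left (by linarith [(hclamp r).2]) K.2
      exact hlip.continuous
    have hr : ∀ z, LipschitzWith L fun r => α z (max 0 (min r T)) := by
      intro z
      have h1 : LipschitzOnWith L (α z) (Icc 0 T) :=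
        (convex_Icc 0 T).lipschitzOnWith_of_nnnorm_hasDerivWithin_le (hα z)
          (fun r _ => by exact_mod_cast hL (α z r))
      have h2 : LipschitzWith 1 fun r : ℝ => max 0 (min r T) :=
        (LipschitzWith.id.min_const T).const_max 0
      have := h1.comp (h2.lipschitzOnWith (s := univ)) (fun r _ => hclamp r)
      rw [mul_one] at this
      exact lipschitzOnWith_univ.1 this
    exact continuous_prod_of_continuous_lipschitzWith' _ L (fun r => hr r) hz
  · simp only [hid 0 ⟨le_refl 0, hT⟩, hα0]
  · simp only [hid r hr]
    exact (hα z r hr).congr (fun y hy => by rw [hid y hy]) (by rw [hid r hr])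

end LipschitzFlow

/-! ### Logarithmic coordinate and truncation. -/

section LogField

/-- The polynomial vector field `p` in the coordinate `z = log x`, frozen for `z ≥ N`. -/
noncomputable def logField (p : ℝ[X]) (N z : ℝ) : ℝ := p.divX.eval (Real.exp (min z N))

/-- This is where `p(0) = 0` enters: along an orbit `(log u)' = p(u) / u` is again a polynomial in
`u`, with no singularity at `0`. -/
lemma eval_eq_mul_divX {p : ℝ[X]} (hp : p.eval 0 = 0) (y : ℝ) :
    p.eval y = y * p.divX.eval y := by
  conv_lhs => rw [← Polynomial.divX_mul_X_add p]
  rw [← Polynomial.coeff_zero_eq_eval_zero] at hp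
  simp [hp, mul_comm]

/-- The truncation keeps `exp (min z N)` in the compact interval `[0, exp N]`, where a polynomial is
bounded and Lipschitz. -/
lemma logField_lipschitz_bounded (p : ℝ[X]) (N : ℝ) :
    ∃ K L : ℝ≥0, LipschitzWith K (logField p N) ∧ ∀ z, ‖logField p N z‖ ≤ L := by
  have hmem : ∀ z, Real.exp (min z N) ∈ Icc 0 (Real.exp N) := fun z =>
    ⟨(Real.exp_pos _).le, Real.exp_le_exp.2 (min_le_right _ _)⟩
  have hcd : ContDiff ℝ 1 fun y => p.divX.eval y := by
    simpa [Polynomial.aeval_def] using (p.divX.contDiff_aeval (𝕜 := ℝ) 1)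
  obtain ⟨K₁, hK₁⟩ := (hcd.contDiffOn (s := Icc 0 (Real.exp N))).exists_lipschitzOnWith
    one_ne_zero (convex_Icc _ _) isCompact_Icc
  obtain ⟨L, hL⟩ := isCompact_Icc.exists_bound_of_continuousOn
    (p.divX.continuous.continuousOn (s := Icc 0 (Real.exp N)))
  have h2 : LipschitzOnWith (Real.toNNReal (Real.exp N)) Real.exp (Iic N) := by
    refine (convex_Iic N).lipschitzOnWith_of_nnnorm_hasDerivWithin_le
      (fun x _ => (Real.hasDerivAt_exp x).hasDerivWithinAt) fun x hx => ?_
    rw [← NNReal.coe_le_coe, Real.coe_toNNReal _ (Real.exp_pos _).le, coe_nnnorm, Real.norm_eq_abs,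
      abs_of_pos (Real.exp_pos _)]
    exact Real.exp_le_exp.2 hx
  have h3 : LipschitzOnWith 1 (fun z : ℝ => min z N) univ :=
    (LipschitzWith.id.min_const N).lipschitzOnWith
  have h4 := hK₁.comp (h2.comp h3 (fun z _ => mem_Iic.2 (min_le_right _ _))) (fun z _ => hmem z)
  refine ⟨_, Real.toNNReal L, lipschitzOnWith_univ.1 h4, fun z => ?_⟩
  exact (hL _ (hmem z)).trans (Real.le_coe_toNNReal L)

lemma exists_logFlow (p : ℝ[X]) (N : ℕ) :
    ∃ Z : ℝ → ℝ → ℝ, Continuous (Function.uncurry Z) ∧ ∀ z, Z z 0 = z ∧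
      ∀ r ∈ Icc (0 : ℝ) N, HasDerivWithinAt (Z z) (logField p N (Z z r)) (Icc (0 : ℝ) N) r := by
  obtain ⟨K, L, hK, hL⟩ := logField_lipschitz_bounded p N
  exact exists_continuous_flow hK hL (Nat.cast_nonneg N)

/-- The flow of `logField p N` on `[0, N]`. -/
noncomputable def logFlow (p : ℝ[X]) (N : ℕ) : ℝ → ℝ → ℝ := (exists_logFlow p N).choose

lemma continuous_logFlow (p : ℝ[X]) (N : ℕ) : Continuous (Function.uncurry (logFlow p N)) :=
  (exists_logFlow p N).choose_spec.1

lemma logFlow_zero (p : ℝ[X]) (N : ℕ) (z : ℝ) : logFlow p N z 0 = z :=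
  ((exists_logFlow p N).choose_spec.2 z).1

lemma hasDerivWithinAt_logFlow (p : ℝ[X]) (N : ℕ) (z : ℝ) {r : ℝ} (hr : r ∈ Icc (0 : ℝ) N) :
    HasDerivWithinAt (logFlow p N z) (logField p N (logFlow p N z r)) (Icc (0 : ℝ) N) r :=
  ((exists_logFlow p N).choose_spec.2 z).2 r hr

lemma continuous_logFlow_right (p : ℝ[X]) (N : ℕ) (z : ℝ) : Continuous (logFlow p N z) :=
  (continuous_logFlow p N).comp (Continuous.prodMk_right z)

end LogField

/-! ### The polynomial flow and its lifetime. -/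

section Flow

lemma IsSolution.continuousOn {v u : ℝ → ℝ} {x s : ℝ} (h : IsSolution v x s u) :
    ContinuousOn u (Icc 0 s) := fun r hr => (h.2 r hr).2.continuousWithinAt

lemma IsSolution.mono {v u : ℝ → ℝ} {x r s : ℝ} (h : IsSolution v x s u) (hrs : r ≤ s) :
    IsSolution v x r u :=
  ⟨h.1, fun t ht => ⟨(h.2 t (Icc_subset_Icc_right hrs ht)).1,
    (h.2 t (Icc_subset_Icc_right hrs ht)).2.mono (Icc_subset_Icc_right hrs)⟩⟩

lemma IsSolution.pos {v u : ℝ → ℝ} {x s : ℝ} (h : IsSolution v x s u) (hs : 0 ≤ s) : 0 < x := by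
  rw [← h.1]
  exact (h.2 0 ⟨le_rfl, hs⟩).1

variable {p : ℝ[X]}

/-- In the logarithmic coordinate, a solution bounded by `exp N` is an orbit of `logFlow p N`. -/
lemma IsSolution.logFlow_eq (hp : p.eval 0 = 0) {x s : ℝ} {u : ℝ → ℝ}
    (h : IsSolution (fun y => p.eval y) x s u) {N : ℕ} (hs : s ≤ N)
    (hN : ∀ r ∈ Icc 0 s, u r ≤ Real.exp N) :
    ∀ r ∈ Icc 0 s, logFlow p N (Real.log x) r = Real.log (u r) := by
  obtain ⟨K, L, hK, hL⟩ := logField_lipschitz_bounded p N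
  have hsub : Icc 0 s ⊆ Icc (0 : ℝ) N := Icc_subset_Icc_right hs
  have hder : ∀ r ∈ Icc 0 s, HasDerivWithinAt (fun r => Real.log (u r))
      (logField p N (Real.log (u r))) (Icc 0 s) r := by
    intro r hr
    have hpos := (h.2 r hr).1
    have := (h.2 r hr).2.log hpos.ne'
    convert this using 1
    have hle : Real.log (u r) ≤ N := (Real.log_le_iff_le_exp hpos).2 (hN r hr)
    beta_reduce
    rw [logField, min_eq_left hle, Real.exp_log hpos, eval_eq_mul_divX hp]
    field_simp
  refine ODE_solution_unique_of_mem_Icc_right (v := fun _ => logField p N) (s := fun _ => univ)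
    (K := K) (fun _ _ => hK.lipschitzOnWith) (continuous_logFlow_right p N _).continuousOn
    (fun t ht => hasDerivWithinAt_Ici_of_Icc
      ((hasDerivWithinAt_logFlow p N _ (hsub (Ico_subset_Icc_self ht))).mono hsub) ht)
    (fun _ _ => trivial) (fun r hr => (hder r hr).continuousWithinAt)
    (fun t ht => hasDerivWithinAt_Ici_of_Icc (hder t (Ico_subset_Icc_self ht)) ht)
    (fun _ _ => trivial) ?_
  simp only [logFlow_zero, h.1]

lemma isSolution_exp_logFlow (hp : p.eval 0 = 0) {x s : ℝ} (hx : 0 < x) {N : ℕ} (hs : s ≤ N)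
    (hN : ∀ r ∈ Icc 0 s, logFlow p N (Real.log x) r ≤ N) :
    IsSolution (fun y => p.eval y) x s fun r => Real.exp (logFlow p N (Real.log x) r) := by
  refine ⟨by simp only [logFlow_zero, Real.exp_log hx], fun r hr => ⟨Real.exp_pos _, ?_⟩⟩
  have hsub : Icc 0 s ⊆ Icc (0 : ℝ) N := Icc_subset_Icc_right hs
  have := ((hasDerivWithinAt_logFlow p N (Real.log x) (hsub hr)).mono hsub).exp
  convert this using 1
  beta_reduce
  rw [eval_eq_mul_divX hp, logField, min_eq_left (hN r hr)]

/-- The bound holds for all large `N`, so that two solutions can be compared within a common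
truncation. -/
lemma IsSolution.exists_bound {v u : ℝ → ℝ} {x s : ℝ} (h : IsSolution v x s u) :
    ∃ M : ℕ, ∀ N : ℕ, M ≤ N → s ≤ N ∧ ∀ r ∈ Icc 0 s, u r ≤ Real.exp N := by
  obtain ⟨C, hC⟩ := isCompact_Icc.exists_bound_of_continuousOn h.continuousOn
  obtain ⟨M, hM⟩ := exists_nat_ge (max s C)
  refine ⟨M, fun N hMN => ?_⟩
  have hN : max s C ≤ N := hM.trans (by exact_mod_cast hMN)
  refine ⟨(le_max_left _ _).trans hN, fun r hr => ?_⟩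
  calc u r ≤ ‖u r‖ := Real.le_norm_self _
    _ ≤ C := hC r hr
    _ ≤ N := (le_max_right _ _).trans hN
    _ ≤ Real.exp N := (by linarith [Real.add_one_le_exp (N : ℝ)])

lemma IsSolution.eqOn (hp : p.eval 0 = 0) {x s : ℝ} {u w : ℝ → ℝ}
    (hu : IsSolution (fun y => p.eval y) x s u) (hw : IsSolution (fun y => p.eval y) x s w) :
    EqOn u w (Icc 0 s) := by
  obtain ⟨M, hM⟩ := hu.exists_bound
  obtain ⟨M', hM'⟩ := hw.exists_bound
  have h1 := hM _ (le_max_left M M')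
  have h2 := hM' _ (le_max_right M M')
  intro r hr
  refine Real.log_injOn_pos (hu.2 r hr).1 (hw.2 r hr).1 ?_
  rw [← hu.logFlow_eq hp h1.1 h1.2 r hr, ← hw.logFlow_eq hp h2.1 h2.2 r hr]

lemma Survives.mono {v : ℝ → ℝ} {x r s : ℝ} (h : Survives v x s) (hr : 0 ≤ r) (hrs : r ≤ s) :
    Survives v x r := ⟨hr, h.2.imp fun _ hu => hu.mono hrs⟩

lemma Survives.pos {v : ℝ → ℝ} {x s : ℝ} (h : Survives v x s) : 0 < x := by
  obtain ⟨u, hu⟩ := h.2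
  exact hu.pos h.1

lemma flow_eq (hp : p.eval 0 = 0) {x s r : ℝ} {u : ℝ → ℝ}
    (hu : IsSolution (fun y => p.eval y) x s u) (hr : r ∈ Icc 0 s) :
    flow (fun y => p.eval y) x r = u r := by
  have hex : ∃ u, IsSolution (fun y => p.eval y) x r u := ⟨u, hu.mono hr.2⟩
  rw [flow, dif_pos hex]
  exact hex.choose_spec.eqOn hp (hu.mono hr.2) ⟨hr.1, le_rfl⟩

lemma Survives.isSolution_flow (hp : p.eval 0 = 0) {x s : ℝ}
    (h : Survives (fun y => p.eval y) x s) :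
    IsSolution (fun y => p.eval y) x s (flow (fun y => p.eval y) x) := by
  obtain ⟨hs, u, hu⟩ := h
  refine ⟨by rw [flow_eq hp hu ⟨le_rfl, hs⟩, hu.1], fun r hr => ?_⟩
  rw [flow_eq hp hu hr]
  exact ⟨(hu.2 r hr).1, (hu.2 r hr).2.congr (fun y hy => flow_eq hp hu hy) (flow_eq hp hu hr)⟩

lemma survives_zero (hp : p.eval 0 = 0) {x : ℝ} (hx : 0 < x) :
    Survives (fun y => p.eval y) x 0 := by
  obtain ⟨N, hN⟩ := exists_nat_ge (Real.log x)
  refine ⟨le_rfl, _, isSolution_exp_logFlow hp hx (N := N) (Nat.cast_nonneg N) fun r hr => ?_⟩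
  rw [le_antisymm hr.2 hr.1, logFlow_zero]
  exact hN

lemma flow_zero (hp : p.eval 0 = 0) {x : ℝ} (hx : 0 < x) :
    flow (fun y => p.eval y) x 0 = x :=
  ((survives_zero hp hx).isSolution_flow hp).1

lemma flow_of_not_survives {v : ℝ → ℝ} {x r : ℝ} (hr : 0 ≤ r) (h : ¬ Survives v x r) :
    flow v x r = 0 := by
  rw [flow, dif_neg]
  exact fun hu => h ⟨hr, hu⟩

/-- Times up to `r` are parametrized as `θ * r` with `θ` in a fixed interval. For each `N` the
condition is then an intersection of closed conditions on `(log x, r)`, which gives measurability of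
the lifetime. -/
lemma survives_iff (hp : p.eval 0 = 0) {x r : ℝ} :
    Survives (fun y => p.eval y) x r ↔ 0 < x ∧ 0 ≤ r ∧ ∃ N : ℕ, r ≤ N ∧
      ∀ θ ∈ Icc (0 : ℝ) 1, logFlow p N (Real.log x) (θ * r) ≤ N := by
  constructor
  · intro h
    obtain ⟨hr, u, hu⟩ := h
    obtain ⟨N, hN⟩ := hu.exists_bound
    obtain ⟨h1, h2⟩ := hN N le_rfl
    refine ⟨hu.pos hr, hr, N, h1, fun θ hθ => ?_⟩
    have hm : θ * r ∈ Icc 0 r := ⟨mul_nonneg hθ.1 hr, mul_le_of_le_one_left hr hθ.2⟩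
    rw [hu.logFlow_eq hp h1 h2 _ hm]
    exact (Real.log_le_iff_le_exp (hu.2 _ hm).1).2 (h2 _ hm)
  · rintro ⟨hx, hr, N, hrN, h⟩
    refine ⟨hr, _, isSolution_exp_logFlow hp hx hrN fun s hs => ?_⟩
    rcases hr.eq_or_lt with rfl | hr'
    · have := h 0 ⟨le_rfl, zero_le_one⟩
      rwa [zero_mul, ← le_antisymm hs.2 hs.1] at this
    · have := h (s / r) ⟨div_nonneg hs.1 hr, div_le_one_of_le₀ hs.2 hr⟩
      rwa [div_mul_cancel₀ _ hr'.ne'] at this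

/-- An orbit that survives up to time `r` survives a little longer. -/
lemma Survives.exists_gt (hp : p.eval 0 = 0) {x r a : ℝ}
    (h : Survives (fun y => p.eval y) x r) (hra : r < a) :
    ∃ s, r < s ∧ s < a ∧ Survives (fun y => p.eval y) x s := by
  obtain ⟨hr, u, hu⟩ := h
  have hx := hu.pos hr
  obtain ⟨M, hM⟩ := hu.exists_bound
  obtain ⟨h1, h2⟩ := hM M le_rfl
  obtain ⟨h3, h4⟩ := hM (M + 1) (Nat.le_succ M)
  -- The solution is already bounded by `exp M`; truncating at `M + 1` leaves room for a
  -- continuation beyond `r`.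
  have hlt : logFlow p (M + 1) (Real.log x) r < (M + 1 : ℕ) := by
    rw [hu.logFlow_eq hp h3 h4 r ⟨hr, le_rfl⟩]
    have := (Real.log_le_iff_le_exp (hu.2 r ⟨hr, le_rfl⟩).1).2 (h2 r ⟨hr, le_rfl⟩)
    push_cast
    linarith
  have hev : ∀ᶠ s in nhds r, logFlow p (M + 1) (Real.log x) s < (M + 1 : ℕ) :=
    (continuous_logFlow_right p (M + 1) (Real.log x)).continuousAt.eventually_lt
      continuousAt_const hlt
  obtain ⟨δ, hδ, hball⟩ := Metric.eventually_nhds_iff.1 hev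
  have hrM : r < (M + 1 : ℕ) := by push_cast; linarith
  obtain ⟨s, hs1, hs2⟩ := exists_between (lt_min hra (lt_min hrM (lt_add_of_pos_right r hδ)))
  have hs3 := lt_min_iff.1 hs2
  have hs4 := lt_min_iff.1 hs3.2
  refine ⟨s, hs1, hs3.1, hr.trans hs1.le, _,
    isSolution_exp_logFlow hp hx (N := M + 1) hs4.1.le fun t ht => ?_⟩
  rcases le_or_gt t r with htr | htr
  · rw [hu.logFlow_eq hp h3 h4 t ⟨ht.1, htr⟩]
    exact (Real.log_le_iff_le_exp (hu.2 t ⟨ht.1, htr⟩).1).2 (h4 t ⟨ht.1, htr⟩)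
  · refine (hball ?_).le
    rw [Real.dist_eq, abs_of_pos (sub_pos.2 htr)]
    linarith [ht.2, hs4.2]

/-- An orbit that stays bounded up to time `t`, as long as it exists, exists up to time `t`. -/
lemma survives_of_bounded (hp : p.eval 0 = 0) {x t R : ℝ} (hx : 0 < x) (ht : 0 ≤ t)
    (hR : ∀ r ≤ t, Survives (fun y => p.eval y) x r → flow (fun y => p.eval y) x r ≤ R) :
    Survives (fun y => p.eval y) x t := by
  -- With `N ≥ R + 1` one has `R < exp N` strictly. An orbit below the truncation level is then
  -- strictly below it, which makes the condition open as well as closed in time.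
  obtain ⟨N, hN⟩ := exists_nat_ge (max t (R + 1))
  have htN : t ≤ N := (le_max_left _ _).trans hN
  have hRN : R + 1 ≤ N := (le_max_right _ _).trans hN
  have hRe : R < Real.exp N := by linarith [Real.add_one_le_exp (N : ℝ)]
  have hcont := continuous_logFlow_right p N (Real.log x)
  set s : Set ℝ := {r | ∀ q ∈ Icc 0 r, logFlow p N (Real.log x) q ≤ N} with hs
  have key : ∀ r ∈ s, r ∈ Icc 0 t → logFlow p N (Real.log x) r < N := by
    intro r hr hrt
    have hsol := isSolution_exp_logFlow hp hx (hrt.2.trans htN) hr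
    have := hR r hrt.2 ⟨hrt.1, _, hsol⟩
    rw [flow_eq hp hsol ⟨hrt.1, le_rfl⟩] at this
    exact Real.exp_lt_exp.1 (this.trans_lt hRe)
  have hclosed : IsClosed (s ∩ Icc 0 t) := by
    have : s ∩ Icc 0 t = {r | ∀ θ ∈ Icc (0 : ℝ) 1, logFlow p N (Real.log x) (θ * r) ≤ N} ∩
        Icc 0 t := by
      ext r
      simp only [hs, mem_inter_iff, mem_ofPred_eq, and_congr_left_iff]
      intro hrt
      constructor
      · intro h θ hθ
        exact h _ ⟨mul_nonneg hθ.1 hrt.1, mul_le_of_le_one_left hrt.1 hθ.2⟩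
      · intro h q hq
        rcases hrt.1.eq_or_lt with h0 | hr'
        · have := h 0 ⟨le_rfl, zero_le_one⟩
          rwa [zero_mul, ← le_antisymm (hq.2.trans_eq h0.symm) hq.1] at this
        · have := h (q / r) ⟨div_nonneg hq.1 hrt.1, div_le_one_of_le₀ hq.2 hrt.1⟩
          rwa [div_mul_cancel₀ _ hr'.ne'] at this
    rw [this]
    refine IsClosed.inter ?_ isClosed_Icc
    simp only [ofPred_forall]
    exact isClosed_iInter fun θ => isClosed_iInter fun _ =>
      isClosed_le (hcont.comp (continuous_const.mul continuous_id)) continuous_const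
  have h0 : (0 : ℝ) ∈ s := by
    intro q hq
    rw [le_antisymm hq.2 hq.1, logFlow_zero]
    have := hR 0 ht (survives_zero hp hx)
    rw [flow_zero hp hx] at this
    exact (Real.log_le_iff_le_exp hx).2 (this.trans hRe.le)
  -- Real induction on `[0, t]`: a closed set containing `0` that can always be continued a little
  -- to the right.
  have hsub := hclosed.Icc_subset_of_forall_exists_gt h0 ?_
  · exact ⟨ht, _, isSolution_exp_logFlow hp hx htN (hsub ⟨ht, le_rfl⟩)⟩
  · rintro r ⟨hrs, hrt⟩ y hy
    have hev : ∀ᶠ q in nhds r, logFlow p N (Real.log x) q < N :=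
      hcont.continuousAt.eventually_lt continuousAt_const (key r hrs (Ico_subset_Icc_self hrt))
    obtain ⟨δ, hδ, hball⟩ := Metric.eventually_nhds_iff.1 hev
    refine ⟨min y (r + δ / 2), fun q hq => ?_, lt_min hy (by linarith), min_le_left _ _⟩
    rcases le_or_gt q r with hqr | hqr
    · exact hrs q ⟨hq.1, hqr⟩
    · refine (hball ?_).le
      rw [Real.dist_eq, abs_of_pos (sub_pos.2 hqr)]
      linarith [hq.2, min_le_right y (r + δ / 2)]

/-! ### Joint measurability of lifetime and flow. -/

section Measurability

lemma measurableSet_logFlow_le (p : ℝ[X]) (N : ℕ) :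
    MeasurableSet {y : ℝ × ℝ | 0 < y.1 ∧ 0 ≤ y.2 ∧ y.2 ≤ N ∧
      ∀ θ ∈ Icc (0 : ℝ) 1, logFlow p N (Real.log y.1) (θ * y.2) ≤ N} := by
  have hclosed : IsClosed {y : ℝ × ℝ | ∀ θ ∈ Icc (0 : ℝ) 1, logFlow p N y.1 (θ * y.2) ≤ N} := by
    simp only [ofPred_forall]
    exact isClosed_iInter fun θ => isClosed_iInter fun _ => isClosed_le
      ((continuous_logFlow p N).comp (continuous_fst.prodMk (continuous_const.mul continuous_snd)))
      continuous_const
  have hm : Measurable fun y : ℝ × ℝ => (Real.log y.1, y.2) :=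
    (Real.measurable_log.comp measurable_fst).prodMk measurable_snd
  exact (measurableSet_lt measurable_const measurable_fst).inter
    ((measurableSet_le measurable_const measurable_snd).inter
      ((measurableSet_le measurable_snd measurable_const).inter (hm hclosed.measurableSet)))

lemma measurableSet_survives (hp : p.eval 0 = 0) :
    MeasurableSet {y : ℝ × ℝ | Survives (fun z => p.eval z) y.1 y.2} := by
  have : {y : ℝ × ℝ | Survives (fun z => p.eval z) y.1 y.2} = ⋃ N : ℕ,
      {y : ℝ × ℝ | 0 < y.1 ∧ 0 ≤ y.2 ∧ y.2 ≤ N ∧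
      ∀ θ ∈ Icc (0 : ℝ) 1, logFlow p N (Real.log y.1) (θ * y.2) ≤ N} := by
    ext y
    simp only [mem_ofPred_eq, survives_iff hp, mem_iUnion]
    tauto
  rw [this]
  exact MeasurableSet.iUnion fun N => measurableSet_logFlow_le p N

lemma measurable_flow (hp : p.eval 0 = 0) :
    Measurable fun y : ℝ × ℝ => flow (fun z => p.eval z) y.1 (max 0 y.2) := by
  set A : ℕ → Set (ℝ × ℝ) := fun N => {y : ℝ × ℝ | 0 < y.1 ∧ 0 ≤ y.2 ∧ y.2 ≤ N ∧
      ∀ θ ∈ Icc (0 : ℝ) 1, logFlow p N (Real.log y.1) (θ * y.2) ≤ N} with hA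
  have hmax : Measurable fun y : ℝ × ℝ => (y.1, max 0 y.2) :=
    measurable_fst.prodMk (measurable_const.max measurable_snd)
  -- `flow` is `0` beyond the lifetime, so it is an indicator. On each piece `A N` of the surviving
  -- set it is the exponential of a continuous flow at `log x`.
  suffices h : Measurable ({y : ℝ × ℝ | Survives (fun z => p.eval z) y.1 y.2}.indicator
      fun y => flow (fun z => p.eval z) y.1 y.2) by
    convert h.comp hmax using 1
    ext y
    simp only [Function.comp, indicator, mem_ofPred_eq]
    split_ifs with hy
    · rfl
    · exact flow_of_not_survives (le_max_left _ _) hy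
  have heq : ∀ N, ∀ y ∈ A N, Survives (fun z => p.eval z) y.1 y.2 ∧
      flow (fun z => p.eval z) y.1 y.2 = Real.exp (logFlow p N (Real.log y.1) y.2) := by
    rintro N y ⟨h1, h2, h3, h4⟩
    refine ⟨(survives_iff hp).2 ⟨h1, h2, N, h3, h4⟩, ?_⟩
    refine flow_eq hp (isSolution_exp_logFlow hp h1 h3 fun s hs => ?_) ⟨h2, le_rfl⟩
    rcases h2.eq_or_lt with h0 | hr'
    · have := h4 0 ⟨le_rfl, zero_le_one⟩
      rwa [zero_mul, ← le_antisymm (hs.2.trans_eq h0.symm) hs.1] at this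
    · have := h4 (s / y.2) ⟨div_nonneg hs.1 h2, div_le_one_of_le₀ hs.2 h2⟩
      rwa [div_mul_cancel₀ _ hr'.ne'] at this
  intro B hB
  classical
  rw [indicator_preimage]
  have hz : MeasurableSet ((fun _ : ℝ × ℝ => (0 : ℝ)) ⁻¹' B) := measurable_const hB
  have hmeas : MeasurableSet ({y : ℝ × ℝ | Survives (fun z => p.eval z) y.1 y.2} ∩
      (fun y => flow (fun z => p.eval z) y.1 y.2) ⁻¹' B) := by
    have : {y : ℝ × ℝ | Survives (fun z => p.eval z) y.1 y.2} ∩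
        (fun y => flow (fun z => p.eval z) y.1 y.2) ⁻¹' B =
        ⋃ N : ℕ, A N ∩ (fun y => Real.exp (logFlow p N (Real.log y.1) y.2)) ⁻¹' B := by
      ext y
      simp only [mem_inter_iff, mem_ofPred_eq, mem_preimage, mem_iUnion]
      constructor
      · rintro ⟨hy, hyB⟩
        obtain ⟨h1, h2, N, h3, h4⟩ := (survives_iff hp).1 hy
        have hyA : y ∈ A N := ⟨h1, h2, h3, h4⟩
        exact ⟨N, hyA, by rwa [← (heq N y hyA).2]⟩
      · rintro ⟨N, hyA, hyB⟩
        exact ⟨(heq N y hyA).1, by rwa [(heq N y hyA).2]⟩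
    rw [this]
    refine MeasurableSet.iUnion fun N => (measurableSet_logFlow_le p N).inter ?_
    exact (Real.measurable_exp.comp ((continuous_logFlow p N).measurable.comp
      ((Real.measurable_log.comp measurable_fst).prodMk measurable_snd))) hB
  have : Set.ite {y : ℝ × ℝ | Survives (fun z => p.eval z) y.1 y.2}
      ((fun y => flow (fun z => p.eval z) y.1 y.2) ⁻¹' B)
      ((0 : ℝ × ℝ → ℝ) ⁻¹' B) =
      ({y : ℝ × ℝ | Survives (fun z => p.eval z) y.1 y.2} ∩
      (fun y => flow (fun z => p.eval z) y.1 y.2) ⁻¹' B) ∪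
      ((fun _ : ℝ × ℝ => (0 : ℝ)) ⁻¹' B \ {y : ℝ × ℝ | Survives (fun z => p.eval z) y.1 y.2}) := by
    rw [Set.ite, inter_comm]
    rfl
  rw [this]
  exact hmeas.union (hz.diff (measurableSet_survives hp))

end Measurability

end Flow

/-! ### Accumulated hazard and single clocks. -/

section Hazard

variable {p l : ℝ[X]}

/-- The hazard accumulated up to time `r` by a rate `l` along the orbit of `x` under `p`. -/
noncomputable def hazard (p l : ℝ[X]) (x r : ℝ) : ℝ :=
  ∫ u in (0 : ℝ)..r, l.eval (flow (fun y => p.eval y) x u)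

/-- The orbit of `x` under `p`, stopped at time `s`. -/
noncomputable def stoppedFlow (p : ℝ[X]) (x s u : ℝ) : ℝ :=
  flow (fun y => p.eval y) x (max 0 (min u s))

lemma stoppedFlow_of_mem {x s u : ℝ} (hu : u ∈ Icc 0 s) :
    stoppedFlow p x s u = flow (fun y => p.eval y) x u := by
  rw [stoppedFlow, min_eq_left hu.2, max_eq_right hu.1]

lemma Survives.stop_mem {v : ℝ → ℝ} {x s : ℝ} (h : Survives v x s) (u : ℝ) :
    max 0 (min u s) ∈ Icc 0 s :=
  ⟨le_max_left _ _, max_le h.1 (min_le_right _ _)⟩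

lemma continuous_stoppedFlow (hp : p.eval 0 = 0) {x s : ℝ}
    (h : Survives (fun y => p.eval y) x s) : Continuous (stoppedFlow p x s) :=
  (h.isSolution_flow hp).continuousOn.comp_continuous
    (continuous_const.max (continuous_id.min continuous_const)) h.stop_mem

lemma continuous_eval_stoppedFlow (l : ℝ[X]) (hp : p.eval 0 = 0) {x s : ℝ}
    (h : Survives (fun y => p.eval y) x s) : Continuous fun u => l.eval (stoppedFlow p x s u) :=
  l.continuous.comp (continuous_stoppedFlow hp h)

lemma stoppedFlow_pos (hp : p.eval 0 = 0) {x s : ℝ}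
    (h : Survives (fun y => p.eval y) x s) (u : ℝ) : 0 < stoppedFlow p x s u :=
  ((h.isSolution_flow hp).2 _ (h.stop_mem u)).1

/-- The stopped orbit replaces the raw flow, which jumps to `0` past its lifetime, by a globally
continuous function when `s` is a survival time; the integral calculus is done with it. -/
lemma hazard_eq_stopped {x s r : ℝ} (hr : r ∈ Icc 0 s) :
    hazard p l x r = ∫ u in (0 : ℝ)..r, l.eval (stoppedFlow p x s u) := by
  refine intervalIntegral.integral_congr fun u hu => ?_
  rw [uIcc_of_le hr.1] at hu
  rw [stoppedFlow_of_mem ⟨hu.1, hu.2.trans hr.2⟩]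

lemma hazard_zero (x : ℝ) : hazard p l x 0 = 0 := by simp [hazard]

lemma hazard_mono (hp : p.eval 0 = 0) (hl : ∀ y, 0 < y → 0 ≤ l.eval y) {x r s : ℝ}
    (h : Survives (fun y => p.eval y) x s) (hr : 0 ≤ r) (hrs : r ≤ s) :
    hazard p l x r ≤ hazard p l x s := by
  have hc := continuous_eval_stoppedFlow l hp h
  rw [hazard_eq_stopped ⟨hr, hrs⟩, hazard_eq_stopped ⟨h.1, le_rfl⟩,
    ← intervalIntegral.integral_add_adjacent_intervals (hc.intervalIntegrable 0 r)
      (hc.intervalIntegrable r s), le_add_iff_nonneg_right]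
  exact intervalIntegral.integral_nonneg hrs fun u _ => hl _ (stoppedFlow_pos hp h u)

lemma hazard_nonneg (hp : p.eval 0 = 0) (hl : ∀ y, 0 < y → 0 ≤ l.eval y) {x s : ℝ}
    (h : Survives (fun y => p.eval y) x s) : 0 ≤ hazard p l x s := by
  have := hazard_mono hp hl h le_rfl h.1
  rwa [hazard_zero] at this

/-- The waiting time for the hazard to reach `s`. -/
noncomputable def ringTime (p l : ℝ[X]) (x s : ℝ) : ℝ≥0∞ :=
  sInf (ENNReal.ofReal '' {r : ℝ | Survives (fun y => p.eval y) x r ∧ s ≤ hazard p l x r})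

lemma ringTime_lt_iff {x s : ℝ} {a : ℝ≥0∞} :
    ringTime p l x s < a ↔ ∃ r, Survives (fun y => p.eval y) x r ∧ s ≤ hazard p l x r ∧
      ENNReal.ofReal r < a := by
  simp only [ringTime, sInf_lt_iff, exists_mem_image, mem_ofPred_eq, and_assoc]

/-- The infimum is attained: if the hazard were still below `s` at `r`, then by continuity it would
stay below `s` slightly later, up to a time at which the orbit still survives, so the clock could
not have rung by `r`. -/
lemma ringTime_le_iff (hp : p.eval 0 = 0) (hl : ∀ y, 0 < y → 0 ≤ l.eval y) {x r s : ℝ}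
    (h : Survives (fun y => p.eval y) x r) :
    ringTime p l x s ≤ ENNReal.ofReal r ↔ s ≤ hazard p l x r := by
  constructor
  · intro hle
    by_contra! hlt
    obtain ⟨r₁, hr₁, -, hs₁⟩ := h.exists_gt hp (lt_add_one r)
    have hc := continuous_eval_stoppedFlow l hp hs₁
    have hcont : Continuous fun r => ∫ u in (0 : ℝ)..r, l.eval (stoppedFlow p x r₁ u) :=
      intervalIntegral.continuous_primitive (fun a b => hc.intervalIntegrable a b) 0
    rw [hazard_eq_stopped ⟨h.1, hr₁.le⟩] at hlt
    have hev := (hcont.continuousAt (x := r)).eventually_lt continuousAt_const hlt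
    obtain ⟨δ, hδ, hball⟩ := Metric.eventually_nhds_iff.1 hev
    obtain ⟨r₂, h2, h3⟩ := exists_between (lt_min hr₁ (lt_add_of_pos_right r hδ))
    have h4 := lt_min_iff.1 h3
    have h5 := hball (y := r₂)
      (by rw [Real.dist_eq, abs_of_pos (sub_pos.2 h2)]; linarith [h4.2])
    have hr₂ : 0 ≤ r₂ := h.1.trans h2.le
    rw [← hazard_eq_stopped ⟨hr₂, h4.1.le⟩] at h5
    obtain ⟨r₀, h6, h7, h8⟩ := ringTime_lt_iff.1
      (hle.trans_lt ((ENNReal.ofReal_lt_ofReal_iff_of_nonneg h.1).2 h2))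
    have h9 := (ENNReal.ofReal_lt_ofReal_iff_of_nonneg h6.1).1 h8
    exact absurd (h7.trans (hazard_mono hp hl (hs₁.mono hr₂ h4.1.le) h6.1 h9.le)) (not_le.2 h5)
  · exact fun hs => sInf_le ⟨r, ⟨h, hs⟩, rfl⟩

/-- Monotonicity of the hazard and survival slightly beyond `r` allow rational times, turning the
event into a countable union. -/
lemma ringTime_lt_iff_rat (hp : p.eval 0 = 0) (hl : ∀ y, 0 < y → 0 ≤ l.eval y) {x s : ℝ}
    {a : ℝ≥0∞} : ringTime p l x s < a ↔ ∃ r : ℚ, Survives (fun y => p.eval y) x r ∧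
      s ≤ hazard p l x r ∧ ENNReal.ofReal r < a := by
  rw [ringTime_lt_iff]
  refine ⟨?_, fun ⟨r, h⟩ => ⟨r, h⟩⟩
  rintro ⟨r, h1, h2, h3⟩
  obtain ⟨b, hb1, hb2⟩ : ∃ b, r < b ∧ ENNReal.ofReal b ≤ a := by
    obtain ⟨c, hc1, hc2⟩ := ENNReal.lt_iff_exists_nnreal_btwn.1 h3
    refine ⟨c, ?_, by simpa using hc2.le⟩
    exact (Real.toNNReal_lt_iff_lt_coe h1.1).1 (ENNReal.coe_lt_coe.1 hc1)
  obtain ⟨r₁, h4, h5, h6⟩ := h1.exists_gt hp hb1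
  obtain ⟨q, h7, h8⟩ := exists_rat_btwn h4
  have hq : (0 : ℝ) ≤ q := h1.1.trans h7.le
  have h9 := h6.mono hq h8.le
  exact ⟨q, h9, h2.trans (hazard_mono hp hl h9 h1.1 h7.le),
    ((ENNReal.ofReal_lt_ofReal_iff_of_nonneg hq).2 (h8.trans h5)).trans_le hb2⟩

lemma survives_of_ringTime {x s : ℝ} (h : ringTime p l x s ≠ ⊤) :
    Survives (fun y => p.eval y) x (ringTime p l x s).toReal := by
  obtain ⟨r, h1, h2, -⟩ := ringTime_lt_iff.1 h.lt_top
  refine h1.mono ENNReal.toReal_nonneg ?_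
  exact ENNReal.toReal_le_of_le_ofReal h1.1 (sInf_le ⟨r, ⟨h1, h2⟩, rfl⟩)

lemma measurable_hazard (hp : p.eval 0 = 0) {r : ℝ} (hr : 0 ≤ r) :
    Measurable fun x => hazard p l x r := by
  have h1 : StronglyMeasurable fun y : ℝ × ℝ => l.eval (flow (fun z => p.eval z) y.1 (max 0 y.2)) :=
    (l.continuous.measurable.comp (measurable_flow hp)).stronglyMeasurable
  convert (h1.integral_prod_right (ν := volume.restrict (Ioc 0 r))
    (f := fun x u => l.eval (flow (fun z => p.eval z) x (max 0 u)))).measurable using 2 with x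
  rw [hazard, intervalIntegral.integral_of_le hr]
  refine setIntegral_congr_fun measurableSet_Ioc fun u hu => ?_
  rw [max_eq_right hu.1.le]

lemma measurable_ringTime (hp : p.eval 0 = 0) (hl : ∀ y, 0 < y → 0 ≤ l.eval y) :
    Measurable fun y : ℝ × ℝ => ringTime p l y.1 y.2 := by
  refine measurable_of_Iio fun a => ?_
  have : (fun y : ℝ × ℝ => ringTime p l y.1 y.2) ⁻¹' Iio a = ⋃ r : ℚ, {y : ℝ × ℝ |
      Survives (fun y => p.eval y) y.1 r ∧ y.2 ≤ hazard p l y.1 r ∧ ENNReal.ofReal r < a} := by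
    ext y
    simp only [mem_preimage, mem_Iio, ringTime_lt_iff_rat hp hl, mem_iUnion, mem_ofPred_eq]
  rw [this]
  refine MeasurableSet.iUnion fun r => ?_
  rcases lt_or_ge (r : ℝ) 0 with hr | hr
  · convert MeasurableSet.empty
    ext y
    simp only [mem_ofPred_eq, mem_empty_iff_false, iff_false]
    exact fun h => absurd h.1.1 (not_le.2 hr)
  · have hm : Measurable fun y : ℝ × ℝ => (y.1, (r : ℝ)) := measurable_fst.prodMk measurable_const
    exact (hm (measurableSet_survives hp)).inter ((measurableSet_le measurable_snd
      ((measurable_hazard hp hr).comp measurable_fst)).inter (MeasurableSet.const _))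

end Hazard

/-! ### Holding time and one step of the jump chain. -/

section Step

variable {Q : Type*} {F : Q → ℝ[X]} {Λ : Q → Q → ℝ[X]} {γ : Q → Q → ℝ}
  (hΛ : ∀ k l x, 0 < x → 0 ≤ (Λ k l).eval x) (hγ : ∀ k l, 0 < γ k l)

lemma exists_holdingTime_eq [Finite Q] [Nonempty Q] (q : Q) (x : ℝ) (s : Q → ℝ) :
    ∃ l, ringTime (F q) (Λ q l) x (s l) =
      holdingTime (SHS.ofPolynomials F Λ γ hΛ hγ) q x s :=
  exists_eq_ciInf_of_finite (f := fun l => ringTime (F q) (Λ q l) x (s l))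

lemma lt_holdingTime_iff [Finite Q] [Nonempty Q] (hF : ∀ k, (F k).eval 0 = 0) {q : Q} {x r : ℝ} {s : Q → ℝ}
    (h : Survives (fun y => (F q).eval y) x r) :
    ENNReal.ofReal r < holdingTime (SHS.ofPolynomials F Λ γ hΛ hγ) q x s ↔
      ∀ l, hazard (F q) (Λ q l) x r < s l := by
  constructor
  · intro hlt l
    have := hlt.trans_le (iInf_le (fun l => ringTime (F q) (Λ q l) x (s l)) l)
    rwa [← not_le, ringTime_le_iff (hF q) (hΛ q l) h, not_le] at this
  · intro hall
    obtain ⟨l, hl⟩ := exists_holdingTime_eq (F := F) hΛ hγ q x s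
    rw [← hl, ← not_le, ringTime_le_iff (hF q) (hΛ q l) h, not_le]
    exact hall l

lemma survives_holdingTime [Finite Q] [Nonempty Q] {q : Q} {x : ℝ} {s : Q → ℝ}
    (h : holdingTime (SHS.ofPolynomials F Λ γ hΛ hγ) q x s ≠ ⊤) :
    Survives (fun y => (F q).eval y) x
      (holdingTime (SHS.ofPolynomials F Λ γ hΛ hγ) q x s).toReal := by
  obtain ⟨l, hl⟩ := exists_holdingTime_eq (F := F) hΛ hγ q x s
  rw [← hl] at h ⊢
  exact survives_of_ringTime h

lemma measurable_clock (hF : ∀ k, (F k).eval 0 = 0) (q l : Q) :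
    Measurable fun y : ℝ × (Q → ℝ) =>
      clock (SHS.ofPolynomials F Λ γ hΛ hγ) q y.1 l (y.2 l) :=
  (measurable_ringTime (hF q) (hΛ q l)).comp
    (measurable_fst.prodMk ((measurable_pi_apply l).comp measurable_snd))

lemma measurable_holdingTime [Finite Q] (hF : ∀ k, (F k).eval 0 = 0) (q : Q) :
    Measurable fun y : ℝ × (Q → ℝ) =>
      holdingTime (SHS.ofPolynomials F Λ γ hΛ hγ) q y.1 y.2 :=
  Measurable.iInf fun l => measurable_clock hΛ hγ hF q l

lemma measurable_holdingTime_right [Finite Q] (hF : ∀ k, (F k).eval 0 = 0) (q : Q) (x : ℝ) :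
    Measurable fun s : Q → ℝ => holdingTime (SHS.ofPolynomials F Λ γ hΛ hγ) q x s := by
  have hmk : Measurable fun s : Q → ℝ => (x, s) := measurable_const.prodMk measurable_id
  have h := (measurable_holdingTime hΛ hγ hF q).comp hmk
  exact h

/-- The arbitrary tie-break is harmless because it factors through the set of minimizing indices, a
measurable map into the countable space `Finset Q`. -/
lemma measurable_nextDiscrete [Fintype Q] [MeasurableSpace Q] (hF : ∀ k, (F k).eval 0 = 0) (q : Q) :
    Measurable fun y : ℝ × (Q → ℝ) =>
      nextDiscrete (SHS.ofPolynomials F Λ γ hΛ hγ) q y.1 y.2 := by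
  classical
  let _ : MeasurableSpace (Finset Q) := ⊤
  set H := SHS.ofPolynomials F Λ γ hΛ hγ with hH
  let A : ℝ × (Q → ℝ) → Finset Q := fun y =>
    Finset.univ.filter fun l => clock H q y.1 l (y.2 l) = holdingTime H q y.1 y.2
  have hA : Measurable A := by
    refine measurable_to_countable' fun B => ?_
    have : A ⁻¹' {B} = ⋂ l, {y | (clock H q y.1 l (y.2 l) = holdingTime H q y.1 y.2) ↔ l ∈ B} := by
      ext y
      simp [A, Finset.ext_iff]
    rw [this]
    refine MeasurableSet.iInter fun l => ?_
    exact MeasurableSet.iff (measurableSet_eq_fun (measurable_clock hΛ hγ hF q l)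
      (measurable_holdingTime hΛ hγ hF q)) (MeasurableSet.const _)
  let g : Finset Q → Q := fun B => if h : B.Nonempty then h.choose else q
  have hg : Measurable g := measurable_from_top
  convert hg.comp hA using 2 with y
  simp only [nextDiscrete, Function.comp, g, A]

/-- One step of the jump chain. -/
noncomputable def chainStep [Fintype Q] (H : SHS Q) (e : ℝ≥0∞ × Q × ℝ) (s : Q → ℝ) : ℝ≥0∞ × Q × ℝ :=
  (e.1 + holdingTime H e.2.1 e.2.2 s, nextDiscrete H e.2.1 e.2.2 s,
    H.reset e.2.1 (nextDiscrete H e.2.1 e.2.2 s)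
      (flow (H.f e.2.1) e.2.2 (holdingTime H e.2.1 e.2.2 s).toReal))

lemma jumpChain_succ [Fintype Q] (H : SHS Q) (q : Q) (x : ℝ) (s : ℕ → Q → ℝ) (n : ℕ) :
    jumpChain H q x s (n + 1) = chainStep H (jumpChain H q x s n) (s n) := rfl

lemma measurable_chainStep [Fintype Q] [MeasurableSpace Q] [DiscreteMeasurableSpace Q]
    (hF : ∀ k, (F k).eval 0 = 0) :
    Measurable fun y : (ℝ≥0∞ × Q × ℝ) × (Q → ℝ) =>
      chainStep (SHS.ofPolynomials F Λ γ hΛ hγ) y.1 y.2 := by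
  set H := SHS.ofPolynomials F Λ γ hΛ hγ with hH
  have hτ : Measurable fun z : Q × (ℝ × (Q → ℝ)) => holdingTime H z.1 z.2.1 z.2.2 :=
    measurable_from_prod_countable_right fun q => measurable_holdingTime hΛ hγ hF q
  have hn : Measurable fun z : Q × (ℝ × (Q → ℝ)) => nextDiscrete H z.1 z.2.1 z.2.2 :=
    measurable_from_prod_countable_right fun q => measurable_nextDiscrete hΛ hγ hF q
  have hfl : Measurable fun z : Q × (ℝ × ℝ) => flow (H.f z.1) z.2.1 (max 0 z.2.2) :=
    measurable_from_prod_countable_right fun q => measurable_flow (hF q)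
  have hγm : Measurable fun z : Q × Q => γ z.1 z.2 := measurable_of_countable _
  have hπ : Measurable fun y : (ℝ≥0∞ × Q × ℝ) × (Q → ℝ) => (y.1.2.1, (y.1.2.2, y.2)) := by
    fun_prop
  have hτ' := hτ.comp hπ
  have hn' := hn.comp hπ
  have hfl' : Measurable fun y : (ℝ≥0∞ × Q × ℝ) × (Q → ℝ) =>
      flow (H.f y.1.2.1) y.1.2.2 (holdingTime H y.1.2.1 y.1.2.2 y.2).toReal := by
    have := hfl.comp ((measurable_fst.comp hπ).prodMk
      ((measurable_fst.comp (measurable_snd.comp hπ)).prodMk hτ'.ennreal_toReal))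
    convert this using 2 with y
    simp [Function.comp]
  exact ((measurable_fst.comp measurable_fst).add hτ').prodMk (hn'.prodMk
    ((hγm.comp ((measurable_fst.comp hπ).prodMk hn')).mul hfl'))

end Step

/-! ### Random times with a prescribed hazard rate. -/

section Survival

lemma hasDerivAt_exp_neg_integral {rate : ℝ → ℝ} (hrate : Continuous rate) (r : ℝ) :
    HasDerivAt (fun r => Real.exp (-∫ u in (0 : ℝ)..r, rate u))
      (-(rate r * Real.exp (-∫ u in (0 : ℝ)..r, rate u))) r := by
  have h := (intervalIntegral.integral_hasDerivAt_right (hrate.intervalIntegrable 0 r)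
    (hrate.stronglyMeasurableAtFilter _ _) hrate.continuousAt).neg.exp
  simp only [Pi.neg_apply] at h
  convert h using 1
  ring

variable {Ω : Type*} [MeasurableSpace Ω] {μ : Measure Ω} [IsProbabilityMeasure μ]
  {τ : Ω → ℝ≥0∞} {T : ℝ} {rate : ℝ → ℝ}

/-- A random time with hazard rate `rate` on `[0, T]` has there the density
`rate * exp (-∫ rate)`. -/
lemma map_toReal_restrict_eq_withDensity (hτ : Measurable τ) (hT : 0 ≤ T)
    (hrate : Continuous rate) (hrate0 : ∀ r, 0 ≤ rate r)
    (hlaw : ∀ r ∈ Icc 0 T, μ {ω | ENNReal.ofReal r < τ ω} =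
      ENNReal.ofReal (Real.exp (-∫ u in (0 : ℝ)..r, rate u))) :
    (μ.restrict {ω | τ ω ≤ ENNReal.ofReal T}).map (fun ω => (τ ω).toReal) =
      (volume.restrict (Ioc 0 T)).withDensity
        fun r => ENNReal.ofReal (rate r * Real.exp (-∫ u in (0 : ℝ)..r, rate u)) := by
  have hScont : Continuous fun r => Real.exp (-∫ u in (0 : ℝ)..r, rate u) :=
    continuous_iff_continuousAt.2 fun r => (hasDerivAt_exp_neg_integral hrate r).continuousAt
  -- Both measures vanish on `Iic a` for `a < 0`; otherwise both give `1 - exp (-∫ rate)`,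
  -- integrated up to `min a T`.
  refine Measure.ext_of_Iic _ _ fun a => ?_
  rw [Measure.map_apply hτ.ennreal_toReal measurableSet_Iic,
    Measure.restrict_apply (hτ.ennreal_toReal measurableSet_Iic),
    withDensity_apply _ measurableSet_Iic, Measure.restrict_restrict measurableSet_Iic]
  rcases lt_or_ge a 0 with ha | ha
  · have h1 : (fun ω => (τ ω).toReal) ⁻¹' Iic a ∩ {ω | τ ω ≤ ENNReal.ofReal T} = ∅ := by
      ext ω
      simp only [mem_inter_iff, mem_preimage, mem_Iic, mem_empty_iff_false, iff_false, not_and]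
      exact fun h => absurd (ENNReal.toReal_nonneg.trans h) (not_le.2 ha)
    have h2 : Iic a ∩ Ioc 0 T = ∅ := by
      ext r
      simp only [mem_inter_iff, mem_Iic, mem_Ioc, mem_empty_iff_false, iff_false]
      intro h
      linarith [h.1, h.2.1]
    simp [h1, h2]
  · have hb : min a T ∈ Icc 0 T := ⟨le_min ha hT, min_le_right _ _⟩
    have h1 : (fun ω => (τ ω).toReal) ⁻¹' Iic a ∩ {ω | τ ω ≤ ENNReal.ofReal T} =
        {ω | ENNReal.ofReal (min a T) < τ ω}ᶜ := by
      ext ω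
      simp only [mem_inter_iff, mem_preimage, mem_Iic, mem_ofPred_eq, mem_compl_iff, not_lt]
      rw [ENNReal.ofReal_mono.map_min, le_min_iff, and_congr_left_iff]
      intro hle
      rw [ENNReal.le_ofReal_iff_toReal_le (ne_top_of_le_ne_top ENNReal.ofReal_ne_top hle) ha]
    have h2 : Iic a ∩ Ioc 0 T = Ioc 0 (min a T) := by
      ext r
      simp only [mem_inter_iff, mem_Iic, mem_Ioc, le_min_iff]
      tauto
    rw [h1, h2, prob_compl_eq_one_sub (measurableSet_lt measurable_const hτ), hlaw _ hb,
      ← ofReal_integral_eq_lintegral_ofReal, ← intervalIntegral.integral_of_le hb.1]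
    · have hFTC := intervalIntegral.integral_eq_sub_of_hasDerivAt (a := 0) (b := min a T)
        (fun r _ => (hasDerivAt_exp_neg_integral hrate r).neg)
        ((hrate.mul hScont).neg.neg.intervalIntegrable _ _)
      simp only [neg_neg, Pi.neg_apply, intervalIntegral.integral_same, neg_zero,
        Real.exp_zero] at hFTC
      rw [hFTC, ← ENNReal.ofReal_one, ← ENNReal.ofReal_sub _ (Real.exp_pos _).le]
      congr 1
      ring
    · exact (hrate.mul hScont).integrableOn_Icc.mono_set Ioc_subset_Icc_self
    · exact Filter.Eventually.of_forall fun r => mul_nonneg (hrate0 r) (Real.exp_pos _).le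

/-- First-jump estimate: `w` bounds the expectation of its value at `T` if the random time `τ` is
later than `T`, and of `g` at `τ` otherwise. -/
theorem lintegral_stopped_le (hτ : Measurable τ) (hT : 0 ≤ T)
    (hrate : Continuous rate) (hrate0 : ∀ r, 0 ≤ rate r)
    (hlaw : ∀ r ∈ Icc 0 T, μ {ω | ENNReal.ofReal r < τ ω} =
      ENNReal.ofReal (Real.exp (-∫ u in (0 : ℝ)..r, rate u)))
    {w w' g : ℝ → ℝ} (hw : ContinuousOn w (Icc 0 T)) (hw' : ∀ r ∈ Ioo 0 T, HasDerivAt w (w' r) r)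
    (hwT : 0 ≤ w T) (hg : Continuous g) (hg0 : ∀ r, 0 ≤ g r)
    (hle : ∀ r ∈ Ioo 0 T, w' r ≤ rate r * (w r - g r)) :
    μ {ω | ENNReal.ofReal T < τ ω} * ENNReal.ofReal (w T) +
      ∫⁻ ω in {ω | τ ω ≤ ENNReal.ofReal T}, ENNReal.ofReal (g (τ ω).toReal) ∂μ ≤
      ENNReal.ofReal (w 0) := by
  set S : ℝ → ℝ := fun r => Real.exp (-∫ u in (0 : ℝ)..r, rate u) with hS
  have hSd : ∀ r, HasDerivAt S (-(rate r * S r)) r := hasDerivAt_exp_neg_integral hrate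
  have hScont : Continuous S := continuous_iff_continuousAt.2 fun r => (hSd r).continuousAt
  have hSpos : ∀ r, 0 < S r := fun r => Real.exp_pos _
  have hdens : Continuous fun r => rate r * S r := hrate.mul hScont
  have hprod : Continuous fun r => rate r * S r * g r := hdens.mul hg
  have h1 : ∫⁻ ω in {ω | τ ω ≤ ENNReal.ofReal T}, ENNReal.ofReal (g (τ ω).toReal) ∂μ =
      ENNReal.ofReal (∫ r in (0 : ℝ)..T, rate r * S r * g r) := by
    rw [← lintegral_map (μ := μ.restrict {ω | τ ω ≤ ENNReal.ofReal T})
      (f := fun r => ENNReal.ofReal (g r)) hg.measurable.ennreal_ofReal hτ.ennreal_toReal,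
      map_toReal_restrict_eq_withDensity hτ hT hrate hrate0 hlaw,
      lintegral_withDensity_eq_lintegral_mul _ hdens.measurable.ennreal_ofReal
        hg.measurable.ennreal_ofReal, intervalIntegral.integral_of_le hT,
      ofReal_integral_eq_lintegral_ofReal
        (hprod.integrableOn_Icc.mono_set Ioc_subset_Icc_self)
        (Filter.Eventually.of_forall fun r =>
          mul_nonneg (mul_nonneg (hrate0 r) (hSpos r).le) (hg0 r))]
    refine lintegral_congr fun r => ?_
    rw [Pi.mul_apply, ← ENNReal.ofReal_mul (mul_nonneg (hrate0 r) (hSpos r).le)]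
  have hint : 0 ≤ ∫ r in (0 : ℝ)..T, rate r * S r * g r :=
    intervalIntegral.integral_nonneg hT fun r _ =>
      mul_nonneg (mul_nonneg (hrate0 r) (hSpos r).le) (hg0 r)
  rw [h1, hlaw T ⟨hT, le_rfl⟩, ← ENNReal.ofReal_mul (hSpos T).le,
    ← ENNReal.ofReal_add (mul_nonneg (hSpos T).le hwT) hint]
  refine ENNReal.ofReal_le_ofReal ?_
  -- With `S` the survival function, `S w + ∫ rate S g` has derivative `S (w' - rate (w - g)) ≤ 0`.
  -- Its values at `T` and at `0` are the two sides of the claim.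
  have hanti : AntitoneOn (fun r => S r * w r + ∫ u in (0 : ℝ)..r, rate u * S u * g u)
      (Icc 0 T) := by
    have hd : ∀ r ∈ Ioo 0 T, HasDerivAt
        (fun r => S r * w r + ∫ u in (0 : ℝ)..r, rate u * S u * g u)
        ((-(rate r * S r) * w r + S r * w' r) + rate r * S r * g r) r := fun r hr =>
      ((hSd r).mul (hw' r hr)).add (intervalIntegral.integral_hasDerivAt_right
        (hprod.intervalIntegrable 0 r) (hprod.stronglyMeasurableAtFilter _ _)
        hprod.continuousAt)
    refine antitoneOn_of_deriv_nonpos (convex_Icc _ _) ?_ ?_ ?_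
    · exact (hScont.continuousOn.mul hw).add
        (intervalIntegral.continuous_primitive
          (fun a b => hprod.intervalIntegrable a b) 0).continuousOn
    · rw [interior_Icc]
      exact fun r hr => (hd r hr).differentiableAt.differentiableWithinAt
    · rw [interior_Icc]
      intro r hr
      rw [(hd r hr).deriv]
      nlinarith [mul_le_mul_of_nonneg_left (hle r hr) (hSpos r).le]
  have := hanti ⟨le_rfl, hT⟩ ⟨hT, le_rfl⟩ hT
  simpa [hS] using this

end Survival

/-! ### Law of the holding time under independent exponential clocks. -/

section Exponential

lemma expMeasure_Ioi {a : ℝ} (ha : 0 ≤ a) :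
    expMeasure 1 (Ioi a) = ENNReal.ofReal (Real.exp (-a)) := by
  have : IsProbabilityMeasure (expMeasure 1) := isProbabilityMeasure_expMeasure one_pos
  have h := cdf_expMeasure_eq one_pos a
  rw [if_pos ha, one_mul] at h
  rw [← compl_Iic, prob_compl_eq_one_sub measurableSet_Iic, ← ofReal_cdf, h, ← ENNReal.ofReal_one,
    ← ENNReal.ofReal_sub _ (by linarith [Real.exp_le_one_iff.2 (neg_nonpos.2 ha)])]
  congr 1
  ring

variable {Q : Type*} [Fintype Q] {F : Q → ℝ[X]} {Λ : Q → Q → ℝ[X]} {γ : Q → Q → ℝ}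
  (hΛ : ∀ k l x, 0 < x → 0 ≤ (Λ k l).eval x) (hγ : ∀ k l, 0 < γ k l)

lemma hazard_sum (hF : ∀ k, (F k).eval 0 = 0) {q : Q} {x r : ℝ}
    (h : Survives (fun y => (F q).eval y) x r) :
    hazard (F q) (∑ l, Λ q l) x r = ∑ l, hazard (F q) (Λ q l) x r := by
  have hr : r ∈ Icc 0 r := ⟨h.1, le_rfl⟩
  simp only [hazard_eq_stopped hr, eval_finsetSum]
  exact intervalIntegral.integral_finsetSum fun l _ =>
    (continuous_eval_stoppedFlow (Λ q l) (hF q) h).intervalIntegrable _ _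

/-- As long as the orbit survives, the holding time exceeds `r` with probability
`exp (-total hazard)`. -/
lemma measure_lt_holdingTime [Nonempty Q] (hF : ∀ k, (F k).eval 0 = 0) {q : Q} {x r : ℝ}
    (h : Survives (fun y => (F q).eval y) x r) :
    Measure.pi (fun _ : Q => expMeasure 1)
      {s | ENNReal.ofReal r < holdingTime (SHS.ofPolynomials F Λ γ hΛ hγ) q x s} =
      ENNReal.ofReal (Real.exp (-hazard (F q) (∑ l, Λ q l) x r)) := by
  have : IsProbabilityMeasure (expMeasure 1) := isProbabilityMeasure_expMeasure one_pos
  have hset : {s | ENNReal.ofReal r < holdingTime (SHS.ofPolynomials F Λ γ hΛ hγ) q x s} =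
      univ.pi fun l => Ioi (hazard (F q) (Λ q l) x r) := by
    ext s
    simp only [mem_ofPred_eq, lt_holdingTime_iff hΛ hγ hF h, mem_univ_pi, mem_Ioi]
  rw [hset, Measure.pi_pi, hazard_sum hF h, ← Finset.sum_neg_distrib, Real.exp_sum,
    ENNReal.ofReal_prod_of_nonneg fun _ _ => (Real.exp_pos _).le]
  exact Finset.prod_congr rfl fun l _ => expMeasure_Ioi (hazard_nonneg (hF q) (hΛ q l) h)

end Exponential

/-! ### Degree comparison and the drift condition. -/

section PolynomialBounds

lemma exists_eval_le_of_coeff_neg {P : ℝ[X]} {n : ℕ} (hn : P.natDegree ≤ n) (hc : P.coeff n < 0) :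
    ∃ C : ℝ, ∀ y, 0 ≤ y → P.eval y ≤ C := by
  have hdeg : P.natDegree = n := le_antisymm hn (le_natDegree_of_ne_zero hc.ne)
  rcases Nat.eq_zero_or_pos n with rfl | hpos
  · rw [eq_C_of_natDegree_eq_zero hdeg]
    exact ⟨P.coeff 0, fun y _ => by simp⟩
  · have ht := P.tendsto_atBot_of_leadingCoeff_nonpos
      (natDegree_pos_iff_degree_pos.1 (hdeg ▸ hpos)) (by rw [leadingCoeff, hdeg]; exact hc.le)
    obtain ⟨R, hR⟩ := Filter.eventually_atTop.1 (ht.eventually_le_atBot 0)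
    obtain ⟨C, hC⟩ := isCompact_Icc.exists_bound_of_continuousOn
      (P.continuous.continuousOn (s := Icc 0 R))
    refine ⟨max C 0, fun y hy => ?_⟩
    rcases le_total y R with h | h
    · exact ((Real.le_norm_self _).trans (hC y ⟨hy, h⟩)).trans (le_max_left _ _)
    · exact (hR y h).trans (le_max_right _ _)

variable {Q : Type*} [Fintype Q] {F : Q → ℝ[X]} {Λ : Q → Q → ℝ[X]}

lemma natDegree_total_le (Λ : Q → Q → ℝ[X]) (k : Q) :
    (∑ l, Λ k l).natDegree ≤ degRate Λ :=
  natDegree_sum_le_of_forall_le _ _ fun l _ =>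
    (Finset.le_sup (f := fun l => (Λ k l).natDegree) (Finset.mem_univ l)).trans
      (Finset.le_sup (f := fun k => Finset.univ.sup fun l => (Λ k l).natDegree)
        (Finset.mem_univ k))

lemma coeff_total (Λ : Q → Q → ℝ[X]) (k : Q) :
    (∑ l, Λ k l).coeff (degRate Λ) = ∑ l, topCoeff Λ k l := by
  rw [finsetSum_coeff]
  rfl

lemma natDegree_field_le (hdeg : degF F ≤ degRate Λ) (k : Q) :
    (F k).natDegree ≤ degRate Λ :=
  (Finset.le_sup (f := fun k => (F k).natDegree) (Finset.mem_univ k)).trans hdeg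

/-- The vector field is dominated by the total jump rate. -/
lemma exists_mul_field_le_rate (hdeg : degF F ≤ degRate Λ)
    (htop : ∀ k, 0 < ∑ l, topCoeff Λ k l) (k : Q) :
    ∃ a : ℝ, 0 < a ∧ ∃ C : ℝ, 0 ≤ C ∧ ∀ y, 0 < y →
      a * (F k).eval y ≤ (∑ l, Λ k l).eval y + C := by
  set β := ∑ l, topCoeff Λ k l with hβ
  set α := (F k).coeff (degRate Λ) with hα
  have hβ0 : 0 < β := htop k
  have hα0 : 0 < |α| + 1 := by positivity
  -- This choice makes the coefficient `a α - β` of degree `deg Λ` negative whatever the sign of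
  -- `α`, including `α = 0`.
  set a := β / (|α| + 1) with ha
  have ha0 : 0 < a := div_pos hβ0 hα0
  obtain ⟨C, hC⟩ := exists_eval_le_of_coeff_neg (P := C a * F k - ∑ l, Λ k l) (n := degRate Λ)
    ((natDegree_sub_le_of_le ((natDegree_C_mul_le _ _).trans (natDegree_field_le hdeg k))
      (natDegree_total_le Λ k)).trans (max_self _).le) (by
        rw [coeff_sub, coeff_C_mul, coeff_total, ← hα, ← hβ, sub_neg]
        calc a * α ≤ a * |α| := mul_le_mul_of_nonneg_left (le_abs_self _) ha0.le
          _ < a * (|α| + 1) := mul_lt_mul_of_pos_left (lt_add_one _) ha0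
          _ = β := div_mul_cancel₀ _ hα0.ne')
  refine ⟨a, ha0, max C 0, le_max_right _ _, fun y hy => ?_⟩
  have := hC y hy.le
  rw [eval_sub, eval_mul, eval_C] at this
  linarith [le_max_left C 0]

/-- The drift condition for the Lyapunov function `y ^ m`. -/
lemma exists_drift (hdeg : degF F ≤ degRate Λ) (htop : ∀ k, 0 < ∑ l, topCoeff Λ k l)
    {g : ℝ} (hg0 : 0 ≤ g) (hg1 : g < 1) {m : ℕ} (hm : m ≠ 0) :
    ∃ c K : ℝ, 0 < c ∧ 0 ≤ K ∧ ∀ k y, 0 < y →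
      c * (y ^ m - K) + m * y ^ (m - 1) * (F k).eval y -
        (∑ l, Λ k l).eval y * ((1 - g ^ m) * y ^ m) ≤ -(∑ l, Λ k l).eval y := by
  have hgm : 0 < 1 - g ^ m := sub_pos.2 (pow_lt_one₀ hg0 hg1 hm)
  -- Smallness of `c` matters only if `deg Λ = 0`: then `c y ^ m` has the same degree `deg Λ + m` as
  -- the jump term and must not outweigh it.
  obtain ⟨c, hc0, hc⟩ : ∃ c : ℝ, 0 < c ∧ ∀ k, c < (1 - g ^ m) * ∑ l, topCoeff Λ k l := by
    rcases isEmpty_or_nonempty Q with _ | _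
    · exact ⟨1, one_pos, fun k => isEmptyElim k⟩
    · obtain ⟨k₀, hk₀⟩ := Finite.exists_min fun k => (1 - g ^ m) * ∑ l, topCoeff Λ k l
      have h0 : 0 < (1 - g ^ m) * ∑ l, topCoeff Λ k₀ l := mul_pos hgm (htop k₀)
      exact ⟨_, half_pos h0, fun k => (half_lt_self h0).trans_le (hk₀ k)⟩
  have hbound : ∀ k, ∃ B : ℝ, ∀ y, 0 ≤ y →
      (C (m : ℝ) * Polynomial.X ^ (m - 1) * F k + (∑ l, Λ k l) + C c * Polynomial.X ^ m -
        C (1 - g ^ m) * (∑ l, Λ k l) * Polynomial.X ^ m).eval y ≤ B := by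
    intro k
    have hf : (C (m : ℝ) * Polynomial.X ^ (m - 1) * F k).natDegree ≤ (m - 1) + degRate Λ :=
      natDegree_mul_le_of_le (natDegree_C_mul_X_pow_le _ _) (natDegree_field_le hdeg k)
    have hx : (C c * Polynomial.X ^ m : ℝ[X]).natDegree ≤ m := natDegree_C_mul_X_pow_le _ _
    have hl := natDegree_total_le Λ k
    have hlx : (C (1 - g ^ m) * (∑ l, Λ k l) * Polynomial.X ^ m).natDegree ≤ degRate Λ + m :=
      natDegree_mul_le_of_le ((natDegree_C_mul_le _ _).trans hl) (natDegree_X_pow_le m)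
    refine exists_eval_le_of_coeff_neg (n := degRate Λ + m) ?_ ?_
    · exact (natDegree_sub_le_of_le (natDegree_add_le_of_le
        (natDegree_add_le_of_le hf hl) hx) hlx).trans (by omega)
    · rw [coeff_sub, coeff_add, coeff_add, coeff_eq_zero_of_natDegree_lt (by omega),
        coeff_eq_zero_of_natDegree_lt (p := ∑ l, Λ k l) (by omega), coeff_C_mul_X_pow,
        coeff_mul_X_pow, coeff_C_mul, coeff_total]
      have := hc k
      split_ifs <;> linarith
  choose B hB using hbound
  obtain ⟨M, hM⟩ : ∃ M : ℝ, ∀ k, B k ≤ M := by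
    obtain ⟨M, hM⟩ := (Set.finite_range B).bddAbove
    exact ⟨M, fun k => hM ⟨k, rfl⟩⟩
  -- `K` is chosen so that `c K` absorbs the common upper bound of the polynomials.
  refine ⟨c, max M 0 / c, hc0, div_nonneg (le_max_right _ _) hc0.le, fun k y hy => ?_⟩
  have h1 := (hB k y hy.le).trans ((hM k).trans (le_max_left M 0))
  have h2 : c * (max M 0 / c) = max M 0 := mul_div_cancel₀ _ hc0.ne'
  simp only [eval_sub, eval_add, eval_mul, eval_C, eval_pow, eval_X] at h1
  rw [mul_sub, h2]
  linarith

end PolynomialBounds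

/-! ### The supersolution and the first-jump estimate. -/

section FirstJump

/-- The supersolution `e^{-cs} y^m + K (1 - e^{-cs})` of the backward equation. -/
noncomputable def lyap (c K : ℝ) (m : ℕ) (s y : ℝ) : ℝ := Real.exp (-(c * s)) * (y ^ m - K) + K

variable {c K : ℝ} {m : ℕ}

lemma lyap_nonneg (hc : 0 < c) (hK : 0 ≤ K) {s y : ℝ} (hs : 0 ≤ s) (hy : 0 ≤ y) :
    0 ≤ lyap c K m s y := by
  have h1 : Real.exp (-(c * s)) ≤ 1 := Real.exp_le_one_iff.2 (neg_nonpos.2 (mul_nonneg hc.le hs))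
  have h2 := mul_nonneg (Real.exp_pos (-(c * s))).le (pow_nonneg hy m)
  have h3 := mul_nonneg (sub_nonneg.2 h1) hK
  rw [lyap]
  linarith

lemma lyap_le (hc : 0 < c) (hK : 0 ≤ K) {s y : ℝ} (hs : 0 ≤ s) (hy : 0 ≤ y) :
    lyap c K m s y ≤ y ^ m + K := by
  have h1 : Real.exp (-(c * s)) ≤ 1 := Real.exp_le_one_iff.2 (neg_nonpos.2 (mul_nonneg hc.le hs))
  have h2 := mul_le_mul_of_nonneg_right h1 (pow_nonneg hy m)
  have h3 := mul_nonneg (Real.exp_pos (-(c * s))).le hK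
  rw [lyap]
  linarith

lemma lyap_zero (y : ℝ) : lyap c K m 0 y = y ^ m := by simp [lyap]

lemma lyap_mono {s y z : ℝ} (hy : 0 ≤ y) (hyz : y ≤ z) : lyap c K m s y ≤ lyap c K m s z := by
  rw [lyap, lyap]
  gcongr

lemma hasDerivAt_stoppedFlow {p : ℝ[X]} (hp : p.eval 0 = 0) {x s r : ℝ}
    (h : Survives (fun y => p.eval y) x s) (hr : r ∈ Ioo 0 s) :
    HasDerivAt (stoppedFlow p x s) (p.eval (stoppedFlow p x s r)) r := by
  have hr' := Ioo_subset_Icc_self hr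
  have h1 := (((h.isSolution_flow hp).2 r hr').2).hasDerivAt (Icc_mem_nhds hr.1 hr.2)
  rw [stoppedFlow_of_mem hr']
  refine h1.congr_of_eventuallyEq ?_
  filter_upwards [Icc_mem_nhds hr.1 hr.2] with u hu using stoppedFlow_of_mem hu

variable {Q : Type*} [Fintype Q] {F : Q → ℝ[X]} {Λ : Q → Q → ℝ[X]} {γ : Q → Q → ℝ}

lemma eval_total_nonneg (hΛ : ∀ k l x, 0 < x → 0 ≤ (Λ k l).eval x) (k : Q) {y : ℝ} (hy : 0 < y) :
    0 ≤ (∑ l, Λ k l).eval y := by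
  rw [eval_finsetSum]
  exact Finset.sum_nonneg fun l _ => hΛ k l y hy

/-- The hazard controls the position of the orbit. -/
lemma mul_flow_le_hazard (hF : ∀ k, (F k).eval 0 = 0) {q : Q} {a C : ℝ}
    (haC : ∀ y, 0 < y → a * (F q).eval y ≤ (∑ l, Λ q l).eval y + C) {x r : ℝ}
    (h : Survives (fun y => (F q).eval y) x r) :
    a * (flow (fun y => (F q).eval y) x r - x) ≤ hazard (F q) (∑ l, Λ q l) x r + C * r := by
  have hr : r ∈ Icc 0 r := ⟨h.1, le_rfl⟩
  have hcf := continuous_eval_stoppedFlow (F q) (hF q) h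
  have hcl := continuous_eval_stoppedFlow (∑ l, Λ q l) (hF q) h
  have h1 := intervalIntegral.integral_eq_sub_of_hasDerivAt_of_le h.1
    (continuous_stoppedFlow (hF q) h).continuousOn
    (fun u hu => hasDerivAt_stoppedFlow (hF q) h hu) (hcf.intervalIntegrable 0 r)
  rw [stoppedFlow_of_mem hr, stoppedFlow_of_mem ⟨le_rfl, h.1⟩, flow_zero (hF q) h.pos] at h1
  have h2 : (∫ _ in (0 : ℝ)..r, C) = C * r := by simp [mul_comm]
  rw [← h1, hazard_eq_stopped hr, ← h2, ← intervalIntegral.integral_const_mul,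
    ← intervalIntegral.integral_add (hcl.intervalIntegrable 0 r) intervalIntegrable_const]
  exact intervalIntegral.integral_mono_on h.1 ((continuous_const.mul hcf).intervalIntegrable 0 r)
    ((hcl.add continuous_const).intervalIntegrable 0 r)
    fun u _ => haC _ (stoppedFlow_pos (hF q) h u)

variable [Nonempty Q] (hΛ : ∀ k l x, 0 < x → 0 ≤ (Λ k l).eval x) (hγ : ∀ k l, 0 < γ k l)

/-- The process almost surely jumps before its orbit explodes. -/
lemma measure_lt_holdingTime_eq_zero (hF : ∀ k, (F k).eval 0 = 0) {q : Q} {a C : ℝ} (ha : 0 < a)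
    (hC : 0 ≤ C) (haC : ∀ y, 0 < y → a * (F q).eval y ≤ (∑ l, Λ q l).eval y + C)
    {x t : ℝ} (hx : 0 < x) (ht : 0 ≤ t) (hns : ¬ Survives (fun y => (F q).eval y) x t) :
    Measure.pi (fun _ : Q => expMeasure 1)
      {s | ENNReal.ofReal t < holdingTime (SHS.ofPolynomials F Λ γ hΛ hγ) q x s} = 0 := by
  have hbd : ∀ M : ℝ, Measure.pi (fun _ : Q => expMeasure 1)
      {s | ENNReal.ofReal t < holdingTime (SHS.ofPolynomials F Λ γ hΛ hγ) q x s} ≤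
      ENNReal.ofReal (Real.exp (-M)) := by
    intro M
    by_contra! hlt
    -- If `{τ > t}` had probability above `e^{-M}`, the hazard could not exceed `M` while the orbit
    -- lives; as the hazard controls the position, the orbit would stay bounded and survive to `t`.
    -- Letting `M → ∞` gives probability zero.
    refine hns (survives_of_bounded (hF q) (R := x + (M + C * t) / a) hx ht fun r hrt hr => ?_)
    have hM : hazard (F q) (∑ l, Λ q l) x r ≤ M := by
      by_contra! hMr
      refine absurd hlt (not_lt.2 ?_)
      calc _ ≤ Measure.pi (fun _ : Q => expMeasure 1)
            {s | ENNReal.ofReal r < holdingTime (SHS.ofPolynomials F Λ γ hΛ hγ) q x s} :=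
            measure_mono fun s hs => (ENNReal.ofReal_le_ofReal hrt).trans_lt hs
        _ = _ := measure_lt_holdingTime hΛ hγ hF hr
        _ ≤ _ := ENNReal.ofReal_le_ofReal (Real.exp_le_exp.2 (neg_le_neg hMr.le))
    have h1 := mul_flow_le_hazard hF haC hr
    have h2 : C * r ≤ C * t := mul_le_mul_of_nonneg_left hrt hC
    rw [← sub_le_iff_le_add', le_div_iff₀ ha]
    linarith
  refine le_antisymm (ge_of_tendsto' (x := Filter.atTop) ?_ hbd) zero_le
  rw [← ENNReal.ofReal_zero]
  exact ENNReal.tendsto_ofReal (Real.tendsto_exp_neg_atTop_nhds_zero)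

variable {g : ℝ}

/-- First-jump estimate up to a time at which the orbit still exists. -/
lemma first_jump_le_of_survives (hF : ∀ k, (F k).eval 0 = 0) (hc : 0 < c) (hK : 0 ≤ K)
    (hg0 : 0 ≤ g) {q : Q}
    (hdrift : ∀ y, 0 < y → c * (y ^ m - K) + m * y ^ (m - 1) * (F q).eval y -
        (∑ l, Λ q l).eval y * ((1 - g ^ m) * y ^ m) ≤ -(∑ l, Λ q l).eval y)
    {x T t ρ : ℝ} (hρ0 : 0 ≤ ρ) (hρ : ρ ≤ Real.exp (-(c * t))) (hTt : T ≤ t)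
    (h : Survives (fun y => (F q).eval y) x T) :
    Measure.pi (fun _ : Q => expMeasure 1)
      {s | ENNReal.ofReal T < holdingTime (SHS.ofPolynomials F Λ γ hΛ hγ) q x s} *
        ENNReal.ofReal (lyap c K m (t - T) (flow (fun y => (F q).eval y) x T)) +
    ∫⁻ s in {s | holdingTime (SHS.ofPolynomials F Λ γ hΛ hγ) q x s ≤ ENNReal.ofReal T},
      ENNReal.ofReal (ρ + lyap c K m
        (t - (holdingTime (SHS.ofPolynomials F Λ γ hΛ hγ) q x s).toReal)
        (g * flow (fun y => (F q).eval y) x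
          (holdingTime (SHS.ofPolynomials F Λ γ hΛ hγ) q x s).toReal))
      ∂Measure.pi (fun _ : Q => expMeasure 1) ≤ ENNReal.ofReal (lyap c K m t x) := by
  have : IsProbabilityMeasure (expMeasure 1) := isProbabilityMeasure_expMeasure one_pos
  set τ : (Q → ℝ) → ℝ≥0∞ := fun s => holdingTime (SHS.ofPolynomials F Λ γ hΛ hγ) q x s with hτ
  have hτm : Measurable τ := measurable_holdingTime_right hΛ hγ hF q x
  set u := stoppedFlow (F q) x T with hu
  have huc : Continuous u := continuous_stoppedFlow (hF q) h
  have hupos : ∀ r, 0 < u r := stoppedFlow_pos (hF q) h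
  have hT := h.1
  have hTT : T ∈ Icc 0 T := ⟨hT, le_rfl⟩
  have h0T : (0 : ℝ) ∈ Icc 0 T := ⟨le_rfl, hT⟩
  set rate : ℝ → ℝ := fun r => (∑ l, Λ q l).eval (u r) with hrate
  have hratec : Continuous rate := continuous_eval_stoppedFlow _ (hF q) h
  have hrate0 : ∀ r, 0 ≤ rate r := fun r => eval_total_nonneg hΛ q (hupos r)
  have hw'0 : ∀ r ∈ Ioo 0 T, HasDerivAt (fun r => lyap c K m (t - r) (u r))
      (Real.exp (-(c * (t - r))) *
        (c * (u r ^ m - K) + m * u r ^ (m - 1) * (F q).eval (u r))) r := by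
    intro r hr
    have h1 := hasDerivAt_stoppedFlow (hF q) h hr
    have h2 : HasDerivAt (fun r => -(c * (t - r))) c r :=
      (((hasDerivAt_id r).const_sub t).const_mul c).neg.congr_deriv (by ring)
    have h3 := (h2.exp.mul ((h1.pow m).sub_const K)).add_const K
    rw [← hu] at h3
    exact h3.congr_deriv (by simp only [Pi.pow_apply]; ring)
  -- The time in the post-jump value is clamped to `[0, T]` only to make that value continuous and
  -- nonnegative on all of `ℝ`; the clamp is removed at the end, where the jump time lies in `[0,
  -- T]`.
  have key := lintegral_stopped_le (μ := Measure.pi (fun _ : Q => expMeasure 1)) (τ := τ)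
    (rate := rate) (w := fun r => lyap c K m (t - r) (u r))
    (w' := fun r => Real.exp (-(c * (t - r))) *
        (c * (u r ^ m - K) + m * u r ^ (m - 1) * (F q).eval (u r)))
    (g := fun r => ρ + lyap c K m (t - max 0 (min r T)) (g * u r))
    hτm hT hratec hrate0
    (fun r hr => by
      rw [measure_lt_holdingTime hΛ hγ hF (h.mono hr.1 hr.2), hazard_eq_stopped hr])
    (by unfold lyap; fun_prop) hw'0
    (lyap_nonneg hc hK (sub_nonneg.2 hTt) (hupos T).le)
    (by unfold lyap; fun_prop)
    (fun r => add_nonneg hρ0 (lyap_nonneg hc hK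
      (sub_nonneg.2 ((h.stop_mem r).2.trans hTt)) (mul_nonneg hg0 (hupos r).le)))
    (fun r hr => by
      have hd := hdrift (u r) (hupos r)
      -- The drift inequality gets multiplied by `e^{-c(t - r)} ≥ e^{-ct} ≥ ρ`, so its surplus is at
      -- least `ρ` times the rate: this pays for the reward.
      have he : ρ ≤ Real.exp (-(c * (t - r))) := hρ.trans (Real.exp_le_exp.2 (by
        nlinarith [mul_nonneg hc.le hr.1.le]))
      rw [min_eq_left hr.2.le, max_eq_right hr.1.le, lyap, lyap, mul_pow]
      have h1 := mul_le_mul_of_nonneg_left hd (Real.exp_pos (-(c * (t - r)))).le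
      have h2 := mul_le_mul_of_nonneg_right he (hrate0 r)
      simp only [hrate] at h2 ⊢
      linarith)
  simp only [sub_zero] at key
  rw [hu, stoppedFlow_of_mem hTT, stoppedFlow_of_mem h0T, flow_zero (hF q) h.pos] at key
  refine le_trans (add_le_add le_rfl (le_of_eq ?_)) key
  refine setLIntegral_congr_fun (measurableSet_le hτm measurable_const) fun s hs => ?_
  have hm : (τ s).toReal ∈ Icc 0 T :=
    ⟨ENNReal.toReal_nonneg, ENNReal.toReal_le_of_le_ofReal hT hs⟩
  rw [min_eq_left hm.2, max_eq_right hm.1, stoppedFlow_of_mem hm]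

/-- First-jump estimate, with the value `∞` if the orbit has exploded. -/
theorem first_jump_le (hF : ∀ k, (F k).eval 0 = 0) (hc : 0 < c) (hK : 0 ≤ K)
    (hg0 : 0 ≤ g) {q : Q} {a C : ℝ} (ha : 0 < a)
    (hC : 0 ≤ C) (haC : ∀ y, 0 < y → a * (F q).eval y ≤ (∑ l, Λ q l).eval y + C)
    (hdrift : ∀ y, 0 < y → c * (y ^ m - K) + m * y ^ (m - 1) * (F q).eval y -
        (∑ l, Λ q l).eval y * ((1 - g ^ m) * y ^ m) ≤ -(∑ l, Λ q l).eval y)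
    {x t ρ : ℝ} (hx : 0 < x) (ht : 0 ≤ t) (hρ0 : 0 ≤ ρ) (hρ : ρ ≤ Real.exp (-(c * t)))
    {v : ℝ≥0∞} (hv : Survives (fun y => (F q).eval y) x t →
      v ≤ ENNReal.ofReal (flow (fun y => (F q).eval y) x t ^ m)) :
    Measure.pi (fun _ : Q => expMeasure 1)
      {s | ENNReal.ofReal t < holdingTime (SHS.ofPolynomials F Λ γ hΛ hγ) q x s} * v +
    ∫⁻ s in {s | holdingTime (SHS.ofPolynomials F Λ γ hΛ hγ) q x s ≤ ENNReal.ofReal t},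
      ENNReal.ofReal (ρ + lyap c K m
        (t - (holdingTime (SHS.ofPolynomials F Λ γ hΛ hγ) q x s).toReal)
        (g * flow (fun y => (F q).eval y) x
          (holdingTime (SHS.ofPolynomials F Λ γ hΛ hγ) q x s).toReal))
      ∂Measure.pi (fun _ : Q => expMeasure 1) ≤ ENNReal.ofReal (lyap c K m t x) := by
  by_cases h : Survives (fun y => (F q).eval y) x t
  · have key := first_jump_le_of_survives hΛ hγ hF hc hK hg0 hdrift hρ0 hρ le_rfl h
    rw [sub_self, lyap_zero] at key
    exact le_trans (by gcongr; exact hv h) key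
  · rw [measure_lt_holdingTime_eq_zero hΛ hγ hF ha hC haC hx ht h, zero_mul, zero_add]
    have hlt : ∀ r, Survives (fun y => (F q).eval y) x r → r < t := fun r hr => by
      by_contra! htr
      exact h (hr.mono ht htr)
    -- The orbit explodes by time `t`, but every finite holding time falls strictly within its
    -- lifetime. Hence `{τ ≤ t}` is covered by the increasing events `{τ ≤ r}` with `r` a rational
    -- survival time; the estimate at each `r` passes to the limit by monotone convergence.
    let D := {r : ℚ // Survives (fun y => (F q).eval y) x r}
    let A : D → Set (Q → ℝ) := fun r =>
      {s | holdingTime (SHS.ofPolynomials F Λ γ hΛ hγ) q x s ≤ ENNReal.ofReal (r.1 : ℝ)}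
    have hsub : {s | holdingTime (SHS.ofPolynomials F Λ γ hΛ hγ) q x s ≤ ENNReal.ofReal t} ⊆
        ⋃ r, A r := by
      intro s hs
      have hne := ne_top_of_le_ne_top ENNReal.ofReal_ne_top hs
      have h1 := survives_holdingTime hΛ hγ hne
      obtain ⟨r, h2, -, h3⟩ := h1.exists_gt (hF q) (lt_add_one _)
      obtain ⟨b, h4, h5⟩ := exists_rat_btwn h2
      refine mem_iUnion.2 ⟨⟨b, h3.mono (h1.1.trans h4.le) h5.le⟩, ?_⟩
      exact (ENNReal.le_ofReal_iff_toReal_le hne (h1.1.trans h4.le)).2 h4.le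
    have hdir : Directed (· ⊆ ·) A := by
      have hmono : Monotone A := fun r r' hrr s hs =>
        le_trans (b := ENNReal.ofReal (r.1 : ℝ)) hs
          (ENNReal.ofReal_le_ofReal (by exact_mod_cast hrr))
      exact hmono.directed_le
    refine (lintegral_mono_set hsub).trans ?_
    rw [setLIntegral_iUnion_of_directed _ hdir]
    refine iSup_le fun r => ?_
    exact le_trans le_add_self
      (first_jump_le_of_survives hΛ hγ hF hc hK hg0 hdrift hρ0 hρ (hlt _ r.2).le r.2)

end FirstJump

/-! ### The supersolution along one step of the chain. -/

section ChainStep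

variable {Q : Type*} {F : Q → ℝ[X]} {Λ : Q → Q → ℝ[X]} {γ : Q → Q → ℝ}

open Classical in
/-- The continuous state at time `t` if the last jump before `t` led to `e = (T, q, x)`. -/
noncomputable def stateAfter (F : Q → ℝ[X]) (t : ℝ≥0) (e : ℝ≥0∞ × Q × ℝ) : ℝ≥0∞ :=
  if Survives (fun y => (F e.2.1).eval y) e.2.2 ((t : ℝ≥0∞) - e.1).toReal then
    ENNReal.ofReal (flow (fun y => (F e.2.1).eval y) e.2.2 ((t : ℝ≥0∞) - e.1).toReal) else ⊤

lemma measurable_stateAfter [Countable Q] [MeasurableSpace Q] [DiscreteMeasurableSpace Q]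
    (hF : ∀ k, (F k).eval 0 = 0) (t : ℝ≥0) : Measurable (stateAfter F t) := by
  have h1 : Measurable fun z : Q × (ℝ × ℝ) =>
      flow (fun y => (F z.1).eval y) z.2.1 (max 0 z.2.2) :=
    measurable_from_prod_countable_right fun q => measurable_flow (hF q)
  have h2 : MeasurableSet {z : Q × (ℝ × ℝ) | Survives (fun y => (F z.1).eval y) z.2.1 z.2.2} := by
    refine measurableSet_setOfPred.2 (measurable_from_prod_countable_right fun q => ?_)
    exact measurableSet_setOfPred.1 (measurableSet_survives (hF q))
  have hπ : Measurable fun e : ℝ≥0∞ × Q × ℝ => (e.2.1, (e.2.2, ((t : ℝ≥0∞) - e.1).toReal)) := by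
    fun_prop
  have h3 : Measurable fun e : ℝ≥0∞ × Q × ℝ =>
      flow (fun y => (F e.2.1).eval y) e.2.2 ((t : ℝ≥0∞) - e.1).toReal := by
    convert h1.comp hπ using 2 with e
    simp [Function.comp]
  exact Measurable.ite (hπ h2) h3.ennreal_ofReal measurable_const

/-- The supersolution evaluated after a jump at a time up to `t`. -/
noncomputable def lyapAfter (c K : ℝ) (m : ℕ) (t : ℝ≥0) (e : ℝ≥0∞ × Q × ℝ) : ℝ≥0∞ :=
  {e : ℝ≥0∞ × Q × ℝ | e.1 ≤ t}.indicator
    (fun e => ENNReal.ofReal (lyap c K m (t - e.1.toReal) e.2.2)) e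

lemma measurable_lyapAfter [MeasurableSpace Q] (c K : ℝ) (m : ℕ) (t : ℝ≥0) :
    Measurable (lyapAfter (Q := Q) c K m t) := by
  refine Measurable.indicator ?_ (measurableSet_le measurable_fst measurable_const)
  unfold lyap
  fun_prop

/-- The contribution of the time between two successive jumps `e`, `e'` to the moment at time
`t`, with a reward `ρ` for a jump up to time `t`. -/
noncomputable def stepGain (F : Q → ℝ[X]) (m : ℕ) (t : ℝ≥0) (ρ : ℝ)
    (e e' : ℝ≥0∞ × Q × ℝ) : ℝ≥0∞ :=
  {z : (ℝ≥0∞ × Q × ℝ) × (ℝ≥0∞ × Q × ℝ) | z.1.1 ≤ t ∧ t < z.2.1}.indicator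
    (fun z => stateAfter F t z.1 ^ m) (e, e') +
  {e : ℝ≥0∞ × Q × ℝ | e.1 ≤ t}.indicator (fun _ => ENNReal.ofReal ρ) e'

lemma measurable_stepGain [Countable Q] [MeasurableSpace Q] [DiscreteMeasurableSpace Q]
    (hF : ∀ k, (F k).eval 0 = 0) (m : ℕ) (t : ℝ≥0) (ρ : ℝ) :
    Measurable fun z : (ℝ≥0∞ × Q × ℝ) × (ℝ≥0∞ × Q × ℝ) => stepGain F m t ρ z.1 z.2 := by
  refine Measurable.add (Measurable.indicator ?_ ?_)
    ((measurable_const.indicator (measurableSet_le measurable_fst measurable_const)).comp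
      measurable_snd)
  · exact ((measurable_stateAfter hF t).comp measurable_fst).pow_const m
  · exact (measurableSet_le (measurable_fst.comp measurable_fst) measurable_const).inter
      (measurableSet_lt measurable_const (measurable_fst.comp measurable_snd))

variable [Fintype Q] [Nonempty Q] (hΛ : ∀ k l x, 0 < x → 0 ≤ (Λ k l).eval x)
  (hγ : ∀ k l, 0 < γ k l)

/-- One step of the chain decreases the supersolution by the expected gain. -/
theorem lintegral_chainStep_le (hF : ∀ k, (F k).eval 0 = 0)
    (hdeg : degF F ≤ degRate Λ) (htop : ∀ k, 0 < ∑ l, topCoeff Λ k l)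
    {c K g : ℝ} {m : ℕ} (hc : 0 < c) (hK : 0 ≤ K) (hg : ∀ k l, γ k l ≤ g) (hg0 : 0 ≤ g)
    (hdrift : ∀ k y, 0 < y → c * (y ^ m - K) + m * y ^ (m - 1) * (F k).eval y -
        (∑ l, Λ k l).eval y * ((1 - g ^ m) * y ^ m) ≤ -(∑ l, Λ k l).eval y)
    (t : ℝ≥0) {ρ : ℝ} (hρ0 : 0 ≤ ρ) (hρ : ρ ≤ Real.exp (-(c * t)))
    (e : ℝ≥0∞ × Q × ℝ) (he : 0 < e.2.2) :
    ∫⁻ s, (stepGain F m t ρ e (chainStep (SHS.ofPolynomials F Λ γ hΛ hγ) e s) +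
      lyapAfter c K m t (chainStep (SHS.ofPolynomials F Λ γ hΛ hγ) e s))
      ∂Measure.pi (fun _ : Q => expMeasure 1) ≤ lyapAfter c K m t e := by
  obtain ⟨T, q, x⟩ := e
  set H := SHS.ofPolynomials F Λ γ hΛ hγ with hH
  set τ : (Q → ℝ) → ℝ≥0∞ := fun s => holdingTime H q x s with hτ
  have hτm : Measurable τ := measurable_holdingTime_right hΛ hγ hF q x
  have hfst : ∀ s, (chainStep H (T, q, x) s).1 = T + τ s := fun s => rfl
  rcases lt_or_ge (t : ℝ≥0∞) T with hT | hT
  · have hz : ∀ s, stepGain F m t ρ (T, q, x) (chainStep H (T, q, x) s) +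
        lyapAfter c K m t (chainStep H (T, q, x) s) = 0 := by
      intro s
      have h1 : ¬ (chainStep H (T, q, x) s).1 ≤ t := by
        rw [hfst, not_le]
        exact hT.trans_le le_self_add
      simp [stepGain, lyapAfter, h1, not_le.2 hT]
    simp [hz]
  · have hTtop : T ≠ ⊤ := ne_top_of_le_ne_top ENNReal.coe_ne_top hT
    set t' : ℝ := t - T.toReal with ht'
    have hsub : ((t : ℝ≥0∞) - T).toReal = t' := by
      rw [ENNReal.toReal_sub_of_le hT ENNReal.coe_ne_top, ENNReal.coe_toReal]
    have ht'0 : 0 ≤ t' := hsub ▸ ENNReal.toReal_nonneg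
    have hof : ENNReal.ofReal t' = t - T := by
      rw [← hsub, ENNReal.ofReal_toReal (ENNReal.sub_ne_top ENNReal.coe_ne_top)]
    have hle : ∀ s, T + τ s ≤ t ↔ τ s ≤ ENNReal.ofReal t' := by
      intro s
      rw [hof, ENNReal.le_sub_iff_add_le_left hTtop hT]
    have hlt : ∀ s, (t : ℝ≥0∞) < T + τ s ↔ ENNReal.ofReal t' < τ s := by
      intro s
      rw [← not_le, hle, not_le]
    set v := stateAfter F t (T, q, x) ^ m with hv
    set G : (Q → ℝ) → ℝ≥0∞ := fun s => ENNReal.ofReal (ρ + lyap c K m (t' - (τ s).toReal)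
        (g * flow (fun y => (F q).eval y) x (τ s).toReal)) with hG
    have hms : MeasurableSet {s | ENNReal.ofReal t' < τ s} := measurableSet_lt measurable_const hτm
    have hms' : MeasurableSet {s | τ s ≤ ENNReal.ofReal t'} := measurableSet_le hτm measurable_const
    -- Either no jump occurs in the remaining time `t'`, and the state at `t` is collected, or one
    -- does, and monotonicity of `lyap` in the state replaces the actual factor `γ` by its upper
    -- bound `g`.
    have hpt : ∀ s, stepGain F m t ρ (T, q, x) (chainStep H (T, q, x) s) +
        lyapAfter c K m t (chainStep H (T, q, x) s) ≤
        {s | ENNReal.ofReal t' < τ s}.indicator (fun _ => v) s +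
        {s | τ s ≤ ENNReal.ofReal t'}.indicator G s := by
      intro s
      simp only [stepGain, lyapAfter, indicator, mem_ofPred_eq, hfst, hle, hlt, hT, true_and]
      rcases lt_or_ge (ENNReal.ofReal t') (τ s) with h | h
      · simp [h, not_le.2 h, hv]
      · simp only [h, not_lt.2 h, if_true, if_false, zero_add]
        have hne := ne_top_of_le_ne_top ENNReal.ofReal_ne_top h
        have hsv := survives_holdingTime (q := q) (x := x) (s := s) hΛ hγ hne
        have hfl := ((hsv.isSolution_flow (hF q)).2 _ ⟨hsv.1, le_rfl⟩).1
        have hτt : (τ s).toReal ≤ t' := ENNReal.toReal_le_of_le_ofReal ht'0 h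
        have htime : (t : ℝ) - (T + τ s).toReal = t' - (τ s).toReal := by
          rw [ENNReal.toReal_add hTtop hne, ht']
          ring
        rw [htime, ← ENNReal.ofReal_add hρ0]
        · refine ENNReal.ofReal_le_ofReal (add_le_add le_rfl (lyap_mono ?_ ?_))
          · exact (mul_pos (hγ _ _) hfl).le
          · exact mul_le_mul_of_nonneg_right (hg _ _) hfl.le
        · exact lyap_nonneg hc hK (sub_nonneg.2 hτt) (mul_pos (hγ _ _) hfl).le
    refine (lintegral_mono hpt).trans ?_
    rw [lintegral_add_left (measurable_const.indicator hms), lintegral_indicator_const hms,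
      lintegral_indicator hms', mul_comm]
    obtain ⟨a, ha, C, hC, haC⟩ := exists_mul_field_le_rate hdeg htop q
    -- The remaining time `t'` is at most `t`, so `ρ ≤ e^{-ct} ≤ e^{-ct'}`: the same reward is
    -- affordable at every step.
    have hfin := first_jump_le hΛ hγ hF hc hK hg0 ha hC haC (hdrift q) (x := x) (t := t')
      (ρ := ρ) (v := v) he ht'0 hρ0
      (hρ.trans (Real.exp_le_exp.2 (neg_le_neg (mul_le_mul_of_nonneg_left
        (sub_le_self _ ENNReal.toReal_nonneg) hc.le)))) (fun hsv => by
          rw [hv, stateAfter, hsub, if_pos hsv, ENNReal.ofReal_pow]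
          exact ((hsv.isSolution_flow (hF q)).2 _ ⟨hsv.1, le_rfl⟩).1.le)
    have hR : lyapAfter c K m t (T, q, x) = ENNReal.ofReal (lyap c K m t' x) := by
      simp [lyapAfter, hT, ht']
    rw [hR]
    exact hfin

end ChainStep

/-! ### Pathwise description of the process by its jump chain. -/

section Path

variable {Q : Type*} [Fintype Q]

lemma monotone_jumpChain_fst (H : SHS Q) (q : Q) (x : ℝ) (s : ℕ → Q → ℝ) :
    Monotone fun n => (jumpChain H q x s n).1 :=
  monotone_nat_of_le_succ fun _ => le_self_add

lemma jumpChain_congr (H : SHS Q) (q : Q) (x : ℝ) {s s' : ℕ → Q → ℝ} {n : ℕ}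
    (h : ∀ k < n, s k = s' k) : jumpChain H q x s n = jumpChain H q x s' n := by
  induction n with
  | zero => rfl
  | succ n ih =>
    rw [jumpChain_succ, jumpChain_succ, ih fun k hk => h k (hk.trans n.lt_succ_self),
      h n n.lt_succ_self]

variable {F : Q → ℝ[X]} {Λ : Q → Q → ℝ[X]} {γ : Q → Q → ℝ}
  (hΛ : ∀ k l x, 0 < x → 0 ≤ (Λ k l).eval x) (hγ : ∀ k l, 0 < γ k l)

/-- Jump times are monotone, so the interval containing `t` is unique and the minimal index selected
by `state` is `n`. -/
lemma X_eq_stateAfter {q : Q} {x : ℝ} {s : ℕ → Q → ℝ} {t : ℝ≥0} {n : ℕ}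
    (h1 : (jumpChain (SHS.ofPolynomials F Λ γ hΛ hγ) q x s n).1 ≤ t)
    (h2 : (t : ℝ≥0∞) < (jumpChain (SHS.ofPolynomials F Λ γ hΛ hγ) q x s (n + 1)).1) :
    X (SHS.ofPolynomials F Λ γ hΛ hγ) q x s t =
      stateAfter F t (jumpChain (SHS.ofPolynomials F Λ γ hΛ hγ) q x s n) := by
  classical
  set H := SHS.ofPolynomials F Λ γ hΛ hγ with hH
  have hex : ∃ n, (jumpChain H q x s n).1 ≤ t ∧ (t : ℝ≥0∞) < (jumpChain H q x s (n + 1)).1 :=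
    ⟨n, h1, h2⟩
  have hmono := monotone_jumpChain_fst H q x s
  have hfind : Nat.find hex = n := by
    refine (Nat.find_eq_iff hex).2 ⟨⟨h1, h2⟩, fun k hk hkk => ?_⟩
    exact absurd (hkk.2.trans_le ((hmono (Nat.succ_le_of_lt hk)).trans h1)) (lt_irrefl _)
  have hf : ∀ k, H.f k = fun y => (F k).eval y := fun k => rfl
  unfold X state
  rw [dif_pos hex]
  simp only [hfind, hf, stateAfter]
  split_ifs <;> rfl

lemma X_eq_top {q : Q} {x : ℝ} {s : ℕ → Q → ℝ} {t : ℝ≥0}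
    (h : ∀ n, (jumpChain (SHS.ofPolynomials F Λ γ hΛ hγ) q x s n).1 ≤ t) :
    X (SHS.ofPolynomials F Λ γ hΛ hγ) q x s t = ⊤ := by
  unfold X state
  rw [dif_neg]
  · rfl
  · rintro ⟨n, -, hn⟩
    exact absurd (h (n + 1)) (not_le.2 hn)

/-- Decomposition of a function of the state according to the number of jumps up to time `t`. -/
lemma comp_X_eq_tsum (φ : ℝ≥0∞ → ℝ≥0∞) (q : Q) (x : ℝ) (s : ℕ → Q → ℝ) (t : ℝ≥0) :
    φ (X (SHS.ofPolynomials F Λ γ hΛ hγ) q x s t) =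
      ∑' n, {z : (ℝ≥0∞ × Q × ℝ) × (ℝ≥0∞ × Q × ℝ) | z.1.1 ≤ t ∧ t < z.2.1}.indicator
        (fun z => φ (stateAfter F t z.1))
        (jumpChain (SHS.ofPolynomials F Λ γ hΛ hγ) q x s n,
          jumpChain (SHS.ofPolynomials F Λ γ hΛ hγ) q x s (n + 1)) +
      {Y : ℕ → ℝ≥0∞ × Q × ℝ | ∀ n, (Y n).1 ≤ t}.indicator (fun _ => φ ⊤)
        (jumpChain (SHS.ofPolynomials F Λ γ hΛ hγ) q x s) := by
  classical
  set H := SHS.ofPolynomials F Λ γ hΛ hγ with hH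
  have hmono := monotone_jumpChain_fst H q x s
  by_cases h : ∀ n, (jumpChain H q x s n).1 ≤ t
  · rw [X_eq_top hΛ hγ h, indicator_of_mem (by exact h)]
    have hz : ∀ n, {z : (ℝ≥0∞ × Q × ℝ) × (ℝ≥0∞ × Q × ℝ) | z.1.1 ≤ t ∧ t < z.2.1}.indicator
        (fun z => φ (stateAfter F t z.1)) (jumpChain H q x s n, jumpChain H q x s (n + 1)) = 0 :=
      fun n => indicator_of_notMem (fun hn => absurd (h (n + 1)) (not_le.2 hn.2)) _
    simp [hz]
  · rw [indicator_of_notMem (by exact h), add_zero]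
    have hex : ∃ n, (t : ℝ≥0∞) < (jumpChain H q x s n).1 := by
      push Not at h
      exact h
    obtain ⟨n, hn⟩ : ∃ n, Nat.find hex = n + 1 := Nat.exists_eq_succ_of_ne_zero fun h0 => by
      have := Nat.find_spec hex
      rw [h0] at this
      exact absurd this (not_lt.2 zero_le)
    have h1 : (jumpChain H q x s n).1 ≤ t := not_lt.1 (Nat.find_min hex (hn ▸ n.lt_succ_self))
    have h2 : (t : ℝ≥0∞) < (jumpChain H q x s (n + 1)).1 := hn ▸ Nat.find_spec hex
    rw [X_eq_stateAfter hΛ hγ h1 h2, tsum_eq_single n, indicator_of_mem (by exact ⟨h1, h2⟩)]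
    intro k hk
    refine indicator_of_notMem (fun hkk => ?_) _
    rcases lt_or_gt_of_ne hk with hlt | hgt
    · exact absurd (hkk.2.trans_le ((hmono (Nat.succ_le_of_lt hlt)).trans h1)) (lt_irrefl _)
    · exact absurd (h2.trans_le ((hmono (Nat.succ_le_of_lt hgt)).trans hkk.1)) (lt_irrefl _)

variable [Nonempty Q]

lemma jumpChain_pos (hF : ∀ k, (F k).eval 0 = 0) (q : Q) {x : ℝ} (hx : 0 < x) (s : ℕ → Q → ℝ)
    (n : ℕ) : 0 < (jumpChain (SHS.ofPolynomials F Λ γ hΛ hγ) q x s n).2.2 := by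
  induction n with
  | zero => exact hx
  | succ n ih =>
    set H := SHS.ofPolynomials F Λ γ hΛ hγ with hH
    set e := jumpChain H q x s n with he
    have hsv : Survives (fun y => (F e.2.1).eval y) e.2.2
        (holdingTime H e.2.1 e.2.2 (s n)).toReal := by
      -- If no further jump happens, `toReal` sends the infinite holding time to `0`, and the
      -- meaningless next state is still positive.
      by_cases h : holdingTime H e.2.1 e.2.2 (s n) = ⊤
      · rw [h, ENNReal.toReal_top]
        exact survives_zero (hF _) ih
      · exact survives_holdingTime hΛ hγ h
    exact mul_pos (hγ _ _) ((hsv.isSolution_flow (hF _)).2 _ ⟨hsv.1, le_rfl⟩).1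

end Path

/-! ### Independence of the clocks from the past. -/

section Driving

variable {Q : Type*} [Fintype Q] [MeasurableSpace Q] {Ω : Type*} [MeasurableSpace Ω]
  {P : Measure Ω} {Q₀ : Ω → Q} {X₀ : Ω → ℝ} {S : ℕ → Q → Ω → ℝ}

lemma measurable_jumpChain [DiscreteMeasurableSpace Q] {F : Q → ℝ[X]} {Λ : Q → Q → ℝ[X]}
    {γ : Q → Q → ℝ} (hΛ : ∀ k l x, 0 < x → 0 ≤ (Λ k l).eval x) (hγ : ∀ k l, 0 < γ k l)
    (hF : ∀ k, (F k).eval 0 = 0) (n : ℕ) :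
    Measurable fun z : (Q × ℝ) × (ℕ → Q → ℝ) =>
      jumpChain (SHS.ofPolynomials F Λ γ hΛ hγ) z.1.1 z.1.2 z.2 n := by
  induction n with
  | zero => exact measurable_const.prodMk measurable_fst
  | succ n ih =>
    simp only [jumpChain_succ]
    exact (measurable_chainStep hΛ hγ hF).comp
      (ih.prodMk ((measurable_pi_apply n).comp measurable_snd))

lemma IsDriving.measurable_path (hS : IsDriving P Q₀ X₀ S) [DiscreteMeasurableSpace Q]
    {F : Q → ℝ[X]} {Λ : Q → Q → ℝ[X]}
    {γ : Q → Q → ℝ} (hΛ : ∀ k l x, 0 < x → 0 ≤ (Λ k l).eval x) (hγ : ∀ k l, 0 < γ k l)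
    (hF : ∀ k, (F k).eval 0 = 0) (n : ℕ) :
    Measurable fun ω => jumpChain (SHS.ofPolynomials F Λ γ hΛ hγ) (Q₀ ω) (X₀ ω)
      (fun n l => S n l ω) n :=
  (measurable_jumpChain hΛ hγ hF n).comp ((hS.measurable_Q₀.prodMk hS.measurable_X₀).prodMk
    (measurable_pi_lambda _ fun n => measurable_pi_lambda _ fun l => hS.measurable_S n l))

variable [IsProbabilityMeasure P]

/-- The joint law of `(U, (V, W))` is a triple product; reassociating it moves `V` to the side of
`U`. -/
lemma IndepFun.prodMk_of_indep {α β δ : Type*} [MeasurableSpace α] [MeasurableSpace β]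
    [MeasurableSpace δ] {U : Ω → α} {V : Ω → β} {W : Ω → δ} (hU : Measurable U)
    (hV : Measurable V) (hW : Measurable W) (hVW : IndepFun V W P)
    (hUVW : IndepFun U (fun ω => (V ω, W ω)) P) : IndepFun (fun ω => (U ω, V ω)) W P := by
  have hUV : IndepFun U V P := hUVW.comp measurable_id measurable_fst
  rw [indepFun_iff_map_prod_eq_prod_map_map (hU.prodMk hV).aemeasurable hW.aemeasurable,
    (indepFun_iff_map_prod_eq_prod_map_map hU.aemeasurable hV.aemeasurable).1 hUV]
  have h1 := (indepFun_iff_map_prod_eq_prod_map_map hU.aemeasurable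
    (hV.prodMk hW).aemeasurable).1 hUVW
  rw [(indepFun_iff_map_prod_eq_prod_map_map hV.aemeasurable hW.aemeasurable).1 hVW] at h1
  have : IsProbabilityMeasure (P.map U) := Measure.isProbabilityMeasure_map hU.aemeasurable
  have : IsProbabilityMeasure (P.map V) := Measure.isProbabilityMeasure_map hV.aemeasurable
  have : IsProbabilityMeasure (P.map W) := Measure.isProbabilityMeasure_map hW.aemeasurable
  have h2 : P.map (fun ω => ((U ω, V ω), W ω)) =
      (P.map fun ω => (U ω, (V ω, W ω))).map MeasurableEquiv.prodAssoc.symm := by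
    rw [Measure.map_map MeasurableEquiv.prodAssoc.symm.measurable (hU.prodMk (hV.prodMk hW))]
    rfl
  rw [h2, h1, ← Measure.prodAssoc_prod, Measure.map_map MeasurableEquiv.prodAssoc.symm.measurable
    MeasurableEquiv.prodAssoc.measurable]
  simp

lemma IsDriving.map_clocks (hS : IsDriving P Q₀ X₀ S) (n : ℕ) :
    P.map (fun ω l => S n l ω) = Measure.pi fun _ : Q => expMeasure 1 := by
  have h1 : iIndepFun (fun l => S n l) P :=
    hS.iIndep_S.precomp (g := fun l : Q => (n, l)) (Prod.mk_right_injective n)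
  rw [(iIndepFun_iff_map_fun_eq_pi_map fun l => (hS.measurable_S n l).aemeasurable).1 h1]
  simp only [hS.law_S]

/-- The clocks of a jump are independent of the jumps before. -/
lemma IsDriving.indepFun_jumpChain [DiscreteMeasurableSpace Q] (hS : IsDriving P Q₀ X₀ S)
    {F : Q → ℝ[X]} {Λ : Q → Q → ℝ[X]}
    {γ : Q → Q → ℝ} (hΛ : ∀ k l x, 0 < x → 0 ≤ (Λ k l).eval x) (hγ : ∀ k l, 0 < γ k l)
    (hF : ∀ k, (F k).eval 0 = 0) (n : ℕ) :
    IndepFun (fun ω => jumpChain (SHS.ofPolynomials F Λ γ hΛ hγ) (Q₀ ω) (X₀ ω)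
      (fun n l => S n l ω) n) (fun ω l => S n l ω) P := by
  classical
  -- `A` indexes the clocks of the first `n` jumps, `B` those of the next one.
  let A : Finset (ℕ × Q) := Finset.range n ×ˢ Finset.univ
  let B : Finset (ℕ × Q) := {n} ×ˢ Finset.univ
  have hAB : Disjoint A B := by
    rw [Finset.disjoint_left]
    rintro ⟨k, l⟩ hA hB
    simp only [A, B, Finset.mem_product, Finset.mem_range, Finset.mem_singleton] at hA hB
    omega
  have hm : ∀ i : ℕ × Q, Measurable (S i.1 i.2) := fun i => hS.measurable_S i.1 i.2
  have hVW := hS.iIndep_S.indepFun_finset A B hAB hm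
  have hU : Measurable fun ω => (Q₀ ω, X₀ ω) := hS.measurable_Q₀.prodMk hS.measurable_X₀
  have hV : Measurable fun ω (i : A) => S i.1.1 i.1.2 ω := measurable_pi_lambda _ fun i => hm i
  have hW : Measurable fun ω (i : B) => S i.1.1 i.1.2 ω := measurable_pi_lambda _ fun i => hm i
  have hUVW : IndepFun (fun ω => (Q₀ ω, X₀ ω))
      (fun ω => ((fun i : A => S i.1.1 i.1.2 ω), (fun i : B => S i.1.1 i.1.2 ω))) P := by
    have hψ : Measurable fun s : ℕ × Q → ℝ => ((fun i : A => s i.1), (fun i : B => s i.1)) :=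
      (measurable_pi_lambda _ fun i => measurable_pi_apply _).prodMk
        (measurable_pi_lambda _ fun i => measurable_pi_apply _)
    exact hS.indep_init.comp measurable_id hψ
  have hind := IndepFun.prodMk_of_indep hU hV hW hVW hUVW
  -- Unused clocks are set to `0`: the chain at index `n` does not see them, so it is a function of
  -- the initial state and the clocks in `A` alone.
  let ext : (A → ℝ) → ℕ → Q → ℝ := fun v k l => if h : (k, l) ∈ A then v ⟨(k, l), h⟩ else 0
  have hext : Measurable ext := by
    refine measurable_pi_lambda _ fun k => measurable_pi_lambda _ fun l => ?_
    by_cases h : (k, l) ∈ A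
    · simp only [ext, h, dif_pos]
      exact measurable_pi_apply _
    · simp only [ext, h, dif_neg, not_false_eq_true]
      exact measurable_const
  have hBmem : ∀ l, (n, l) ∈ B := fun l => by simp [B]
  have hproj : Measurable fun (w : B → ℝ) l => w ⟨(n, l), hBmem l⟩ :=
    measurable_pi_lambda _ fun l => measurable_pi_apply _
  have hfinal := hind.comp ((measurable_jumpChain hΛ hγ hF n).comp
    (measurable_fst.prodMk (hext.comp measurable_snd))) hproj
  have heq : ∀ ω, jumpChain (SHS.ofPolynomials F Λ γ hΛ hγ) (Q₀ ω) (X₀ ω)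
      (fun n l => S n l ω) n = jumpChain (SHS.ofPolynomials F Λ γ hΛ hγ) (Q₀ ω) (X₀ ω)
      (ext fun i => S i.1.1 i.1.2 ω) n := by
    refine fun ω => jumpChain_congr _ _ _ fun k hk => ?_
    ext l
    have hkA : (k, l) ∈ A := by simp [A, hk]
    simp [ext, hkA]
  simp only [heq]
  exact hfinal

/-- Expectations along one step of the chain. -/
lemma IsDriving.lintegral_step (hS : IsDriving P Q₀ X₀ S) [DiscreteMeasurableSpace Q]
    {F : Q → ℝ[X]} {Λ : Q → Q → ℝ[X]}
    {γ : Q → Q → ℝ} (hΛ : ∀ k l x, 0 < x → 0 ≤ (Λ k l).eval x) (hγ : ∀ k l, 0 < γ k l)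
    (hF : ∀ k, (F k).eval 0 = 0) (n : ℕ)
    {G : (ℝ≥0∞ × Q × ℝ) × (ℝ≥0∞ × Q × ℝ) → ℝ≥0∞} (hG : Measurable G) :
    ∫⁻ ω, G (jumpChain (SHS.ofPolynomials F Λ γ hΛ hγ) (Q₀ ω) (X₀ ω) (fun n l => S n l ω) n,
      jumpChain (SHS.ofPolynomials F Λ γ hΛ hγ) (Q₀ ω) (X₀ ω) (fun n l => S n l ω) (n + 1)) ∂P =
    ∫⁻ ω, ∫⁻ s, G (jumpChain (SHS.ofPolynomials F Λ γ hΛ hγ) (Q₀ ω) (X₀ ω)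
        (fun n l => S n l ω) n,
      chainStep (SHS.ofPolynomials F Λ γ hΛ hγ) (jumpChain (SHS.ofPolynomials F Λ γ hΛ hγ)
        (Q₀ ω) (X₀ ω) (fun n l => S n l ω) n) s) ∂Measure.pi (fun _ : Q => expMeasure 1) ∂P := by
  have : IsProbabilityMeasure (expMeasure 1) := isProbabilityMeasure_expMeasure one_pos
  have hY := hS.measurable_path hΛ hγ hF n
  have hSn : Measurable fun ω (l : Q) => S n l ω :=
    measurable_pi_lambda _ fun l => hS.measurable_S n l
  set H := SHS.ofPolynomials F Λ γ hΛ hγ with hH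
  have hG' : Measurable fun z : (ℝ≥0∞ × Q × ℝ) × (Q → ℝ) => G (z.1, chainStep H z.1 z.2) :=
    hG.comp (measurable_fst.prodMk (measurable_chainStep hΛ hγ hF))
  have hlaw := (indepFun_iff_map_prod_eq_prod_map_map hY.aemeasurable hSn.aemeasurable).1
    (hS.indepFun_jumpChain hΛ hγ hF n)
  rw [hS.map_clocks n] at hlaw
  have h1 := lintegral_map (μ := P) hG' (hY.prodMk hSn)
  rw [hlaw, lintegral_prod _ hG'.aemeasurable,
    lintegral_map hG'.lintegral_prod_right' hY] at h1
  exact h1.symm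

end Driving

/-! ### Measurability of the state and summation over jumps. -/

section Moments

variable {Q : Type*} [Fintype Q] [MeasurableSpace Q] [DiscreteMeasurableSpace Q]
  {Ω : Type*} [MeasurableSpace Ω]
  {P : Measure Ω} {Q₀ : Ω → Q} {X₀ : Ω → ℝ} {S : ℕ → Q → Ω → ℝ}
  {F : Q → ℝ[X]} {Λ : Q → Q → ℝ[X]} {γ : Q → Q → ℝ}

/-- The measurability of the state at time `t`. -/
lemma IsDriving.measurable_X (hS : IsDriving P Q₀ X₀ S)
    (hΛ : ∀ k l x, 0 < x → 0 ≤ (Λ k l).eval x) (hγ : ∀ k l, 0 < γ k l)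
    (hF : ∀ k, (F k).eval 0 = 0) (t : ℝ≥0) :
    Measurable fun ω => X (SHS.ofPolynomials F Λ γ hΛ hγ) (Q₀ ω) (X₀ ω)
      (fun n l => S n l ω) t := by
  have hY := hS.measurable_path hΛ hγ hF
  have hdec := fun ω => comp_X_eq_tsum (F := F) hΛ hγ id (Q₀ ω) (X₀ ω) (fun n l => S n l ω) t
  simp only [id] at hdec
  simp only [hdec]
  refine Measurable.add (Measurable.tsum fun n => ?_) ?_
  · refine Measurable.comp (g := Set.indicator _ _) (Measurable.indicator
      ((measurable_stateAfter hF t).comp measurable_fst) ?_) ((hY n).prodMk (hY (n + 1)))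
    exact (measurableSet_le (measurable_fst.comp measurable_fst) measurable_const).inter
      (measurableSet_lt measurable_const (measurable_fst.comp measurable_snd))
  · refine Measurable.comp (g := Set.indicator _ _) (measurable_const.indicator ?_)
      (measurable_pi_lambda _ hY)
    simp only [ofPred_forall]
    exact MeasurableSet.iInter fun n =>
      measurableSet_le (measurable_fst.comp (measurable_pi_apply n)) measurable_const

variable [IsProbabilityMeasure P]

/-- The moments of the state are bounded by the Lyapunov estimate. -/
theorem IsDriving.lintegral_X_pow_le [Nonempty Q] (hS : IsDriving P Q₀ X₀ S)
    (hX₀ : ∀ ω, 0 < X₀ ω)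
    (hΛ : ∀ k l x, 0 < x → 0 ≤ (Λ k l).eval x) (hγ : ∀ k l, 0 < γ k l)
    (hF : ∀ k, (F k).eval 0 = 0)
    (hdeg : degF F ≤ degRate Λ) (htop : ∀ k, 0 < ∑ l, topCoeff Λ k l)
    {c K g : ℝ} {m : ℕ} (hc : 0 < c) (hK : 0 ≤ K) (hg : ∀ k l, γ k l ≤ g) (hg0 : 0 ≤ g)
    (hdrift : ∀ k y, 0 < y → c * (y ^ m - K) + m * y ^ (m - 1) * (F k).eval y -
        (∑ l, Λ k l).eval y * ((1 - g ^ m) * y ^ m) ≤ -(∑ l, Λ k l).eval y)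
    (hfin : ∫⁻ ω, ENNReal.ofReal (X₀ ω) ^ m ∂P < ⊤) (t : ℝ≥0) :
    ∫⁻ ω, X (SHS.ofPolynomials F Λ γ hΛ hγ) (Q₀ ω) (X₀ ω) (fun n l => S n l ω) t ^ m ∂P ≤
      ∫⁻ ω, ENNReal.ofReal (X₀ ω) ^ m ∂P + ENNReal.ofReal K := by
  have hY := hS.measurable_path hΛ hγ hF
  set H := SHS.ofPolynomials F Λ γ hΛ hγ with hH
  set Y : ℕ → Ω → ℝ≥0∞ × Q × ℝ := fun n ω =>
    jumpChain H (Q₀ ω) (X₀ ω) (fun n l => S n l ω) n with hYdef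
  set ρ : ℝ := Real.exp (-(c * t)) with hρ
  have hρ0 : 0 < ρ := Real.exp_pos _
  set D : ℕ → Set Ω := fun n => {ω | (Y n ω).1 ≤ t} with hD
  have hDm : ∀ n, MeasurableSet (D n) := fun n =>
    measurableSet_le (measurable_fst.comp (hY n)) measurable_const
  set b : ℕ → Ω → ℝ≥0∞ := fun n ω =>
    {z : (ℝ≥0∞ × Q × ℝ) × (ℝ≥0∞ × Q × ℝ) | z.1.1 ≤ t ∧ t < z.2.1}.indicator
      (fun z => stateAfter F t z.1 ^ m) (Y n ω, Y (n + 1) ω) with hb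
  have hbm : ∀ n, Measurable (b n) := fun n => by
    refine Measurable.comp (g := Set.indicator _ _) (Measurable.indicator
      (((measurable_stateAfter hF t).comp measurable_fst).pow_const m) ?_)
      ((hY n).prodMk (hY (n + 1)))
    exact (measurableSet_le (measurable_fst.comp measurable_fst) measurable_const).inter
      (measurableSet_lt measurable_const (measurable_fst.comp measurable_snd))
  set a : ℕ → ℝ≥0∞ := fun n => ∫⁻ ω, lyapAfter c K m t (Y n ω) ∂P with ha
  -- The expected supersolution after `n` jumps pays for the moment collected between jumps `n` and
  -- `n + 1` and for the reward of jump `n + 1`. Telescoping leaves only `a 0`.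
  have hstep : ∀ n, (∫⁻ ω, b n ω ∂P + ENNReal.ofReal ρ * P (D (n + 1))) + a (n + 1) ≤ a n := by
    intro n
    have hgain : ∫⁻ ω, b n ω ∂P + ENNReal.ofReal ρ * P (D (n + 1)) =
        ∫⁻ ω, stepGain F m t ρ (Y n ω) (Y (n + 1) ω) ∂P := by
      rw [← lintegral_indicator_const (hDm (n + 1)), ← lintegral_add_left (hbm n)]
      rfl
    have hsg := measurable_stepGain hF m t ρ
    have hla := measurable_lyapAfter (Q := Q) c K m t
    have hm1 : Measurable fun ω => stepGain F m t ρ (Y n ω) (Y (n + 1) ω) :=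
      hsg.comp ((hY n).prodMk (hY (n + 1)))
    rw [hgain, ha, ← lintegral_add_left hm1,
      hS.lintegral_step hΛ hγ hF n (G := fun z => stepGain F m t ρ z.1 z.2 + lyapAfter c K m t z.2)
        (hsg.add (hla.comp measurable_snd))]
    exact lintegral_mono fun ω => lintegral_chainStep_le hΛ hγ hF hdeg htop hc hK hg hg0 hdrift t
      hρ0.le le_rfl _ (jumpChain_pos hΛ hγ hF _ (hX₀ ω) _ n)
  have hsum : ∀ n, ∑ i ∈ Finset.range n, (∫⁻ ω, b i ω ∂P + ENNReal.ofReal ρ * P (D (i + 1))) +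
      a n ≤ a 0 := by
    intro n
    induction n with
    | zero => simp
    | succ n ih =>
      rw [Finset.sum_range_succ, add_assoc]
      exact (add_le_add le_rfl (hstep n)).trans ih
  have htsum : ∑' i, ∫⁻ ω, b i ω ∂P + ∑' i, ENNReal.ofReal ρ * P (D (i + 1)) ≤ a 0 := by
    rw [← ENNReal.tsum_add]
    exact ENNReal.tsum_le_of_sum_range_le fun n => le_self_add.trans (hsum n)
  have ha0 : a 0 ≤ ∫⁻ ω, ENNReal.ofReal (X₀ ω) ^ m ∂P + ENNReal.ofReal K := by
    have hle : ∀ ω, lyapAfter c K m t (Y 0 ω) ≤ ENNReal.ofReal (X₀ ω) ^ m + ENNReal.ofReal K := by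
      intro ω
      have h0 : Y 0 ω = (0, Q₀ ω, X₀ ω) := rfl
      have hx := (hX₀ ω).le
      rw [h0, lyapAfter, indicator_of_mem (by simp), ← ENNReal.ofReal_pow hx,
        ← ENNReal.ofReal_add (pow_nonneg hx m) hK]
      simp only [ENNReal.toReal_zero, sub_zero]
      exact ENNReal.ofReal_le_ofReal (lyap_le hc hK t.2 hx)
    refine (lintegral_mono hle).trans ?_
    rw [lintegral_add_right _ measurable_const, lintegral_const, measure_univ, mul_one]
  -- If jumps accumulated by time `t` with positive probability, each of infinitely many terms would
  -- contribute at least the same positive reward, against the finite bound on `a 0`; this uses that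
  -- the initial moment is finite.
  have hnull : P {ω | ∀ n, (Y n ω).1 ≤ t} = 0 := by
    by_contra hne
    have hle : ∀ i : ℕ, ENNReal.ofReal ρ * P {ω | ∀ n, (Y n ω).1 ≤ t} ≤
        ENNReal.ofReal ρ * P (D (i + 1)) := fun i =>
      mul_le_mul_right (measure_mono fun ω (hω : ∀ n, (Y n ω).1 ≤ t) => hω (i + 1)) _
    have htop' : ∑' _ : ℕ, ENNReal.ofReal ρ * P {ω | ∀ n, (Y n ω).1 ≤ t} = ⊤ :=
      ENNReal.tsum_const_eq_top_of_ne_zero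
        (mul_ne_zero (ENNReal.ofReal_pos.2 hρ0).ne' hne)
    have := (ENNReal.tsum_le_tsum hle).trans (le_add_self.trans (htsum.trans ha0))
    rw [htop', top_le_iff] at this
    exact (ENNReal.add_lt_top.2 ⟨hfin, ENNReal.ofReal_lt_top⟩).ne this
  have hdec : ∀ᵐ ω ∂P, X H (Q₀ ω) (X₀ ω) (fun n l => S n l ω) t ^ m = ∑' n, b n ω := by
    have hae : ∀ᵐ ω ∂P, ¬ ∀ n, (Y n ω).1 ≤ t := by
      rw [ae_iff]
      simpa only [not_not] using hnull
    filter_upwards [hae] with ω hω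
    have := comp_X_eq_tsum (F := F) hΛ hγ (fun z => z ^ m) (Q₀ ω) (X₀ ω) (fun n l => S n l ω) t
    rw [indicator_of_notMem (by exact hω), add_zero] at this
    exact this
  rw [lintegral_congr_ae hdec, lintegral_tsum fun n => (hbm n).aemeasurable]
  exact le_self_add.trans (htsum.trans ha0)

end Moments

end HybridSystem

/-! ### The corollary: choice of the constants. -/

theorem mainTheorem10 {Q : Type*} [Fintype Q] [MeasurableSpace Q] [DiscreteMeasurableSpace Q]
    (F : Q → ℝ[X]) (Λ : Q → Q → ℝ[X]) (γ : Q → Q → ℝ)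
    (hF : ∀ k, (F k).eval 0 = 0)
    (hΛ : ∀ k l x, 0 < x → 0 ≤ (Λ k l).eval x)
    (hdeg : HybridSystem.degF F ≤ HybridSystem.degRate Λ)
    (htop : ∀ k, 0 < ∑ l, HybridSystem.topCoeff Λ k l)
    (hγ_pos : ∀ k l, 0 < γ k l) (hγ_lt : ∀ k l, γ k l < 1)
    {Ω : Type*} [MeasurableSpace Ω] (P : Measure Ω) [IsProbabilityMeasure P]
    (Q₀ : Ω → Q) (X₀ : Ω → ℝ) (S : ℕ → Q → Ω → ℝ)
    (hX₀ : ∀ ω, 0 < X₀ ω) (hS : HybridSystem.IsDriving P Q₀ X₀ S)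
    (Xt : ℝ≥0 → Ω → ℝ≥0∞)
    (hXt : ∀ t ω, Xt t ω = HybridSystem.X (HybridSystem.SHS.ofPolynomials F Λ γ hΛ hγ_pos)
      (Q₀ ω) (X₀ ω) (fun n l => S n l ω) t) :
    (∀ t, AEMeasurable (Xt t) P) ∧
    ∀ m : ℕ, ∫⁻ ω, ENNReal.ofReal (X₀ ω) ^ m ∂P < ⊤ →
      ∃ C : ℝ≥0, ∀ t, ∫⁻ ω, Xt t ω ^ m ∂P ≤ C := by
  have hfun : ∀ t, Xt t = fun ω =>
      HybridSystem.X (HybridSystem.SHS.ofPolynomials F Λ γ hΛ hγ_pos)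
        (Q₀ ω) (X₀ ω) (fun n l => S n l ω) t := fun t => funext (hXt t)
  refine ⟨fun t => ?_, fun m hm => ?_⟩
  · rw [hfun]
    exact (hS.measurable_X hΛ hγ_pos hF t).aemeasurable
  -- For `m = 0` there is no contraction (`g ^ 0 = 1`), but the integrand is identically `1`, even
  -- at `∞`.
  · rcases eq_or_ne m 0 with rfl | hm0
    · exact ⟨1, fun t => by simp⟩
    · have : Nonempty Ω := nonempty_of_isProbabilityMeasure P
      have : Nonempty Q := this.map Q₀
      -- Finiteness of `Q` yields a uniform contraction factor `g = γ k₀ l₀ < 1`.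
      obtain ⟨⟨k₀, l₀⟩, hmax⟩ := Finite.exists_max fun z : Q × Q => γ z.1 z.2
      obtain ⟨c, K, hc, hK, hdrift⟩ := HybridSystem.exists_drift (F := F) hdeg htop
        (hγ_pos k₀ l₀).le (hγ_lt k₀ l₀) hm0
      have hlt : ∫⁻ ω, ENNReal.ofReal (X₀ ω) ^ m ∂P + ENNReal.ofReal K < ⊤ :=
        ENNReal.add_lt_top.2 ⟨hm, ENNReal.ofReal_lt_top⟩
      refine ⟨(∫⁻ ω, ENNReal.ofReal (X₀ ω) ^ m ∂P + ENNReal.ofReal K).toNNReal, fun t => ?_⟩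
      rw [ENNReal.coe_toNNReal hlt.ne, hfun]
      exact hS.lintegral_X_pow_le hX₀ hΛ hγ_pos hF hdeg htop hc hK (fun k l => hmax (k, l))
        (hγ_pos k₀ l₀).le hdrift hm t
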